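/- Write $e(x)=e^{2\pi i x}$, let $\tau(n)$ be the number of positive divisors of $n$, and for real $P,Q>0$ let $$\mathcal M(P,Q)=\Big\{\alpha\in\mathbb R:\ \Big|\alpha-\frac aq\Big|\le\frac1{qP}\ \text{for some integers } a,q \text{ with } 1\le q\le Q,\ (a,q)=1\Big\},\qquad \mathfrak m(P,Q)=[0,1]\setminus\mathcal M(P,Q)$$ be the major and minor arcs. Let $k\ge 2$ be an integer, $\gamma=4^{1-k}$ and $\epsilon>0$. Then there is a constant $C>0$, depending only on $k$ and $\epsilon$, such that for every integer $N\ge 2$ and every real polynomial $f$ of degree $k$ whose leading coefficient $\alpha$ lies in the minor arcs $\mathfrak m(P,Q)$ with $P=N$ and $Q=N^{1/2}$, $$\Big|\sum_{n\le N}\tau(n)\,e(f(n))\Big|\le C\,\log N\cdot N^{1+\epsilon-\gamma/2}.$$ -/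

import Mathlib

/-- `e(x) = exp(2 π i x)`. -/
noncomputable def expTwoPiI (x : ℝ) : ℂ :=
  Complex.exp (2 * (Real.pi : ℂ) * Complex.I * (x : ℂ))

/-- The major arcs with parameters `P`, `Q`: the reals `α` admitting a reduced fraction `a / q`
with `1 ≤ q ≤ Q` and `|α - a / q| ≤ 1 / (q P)`. -/
def majorArcs (P Q : ℝ) : Set ℝ :=
  {α | ∃ (a : ℤ) (q : ℕ), 1 ≤ q ∧ (q : ℝ) ≤ Q ∧ IsCoprime a (q : ℤ) ∧
    |α - (a : ℝ) / (q : ℝ)| ≤ 1 / ((q : ℝ) * P)}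

/-- The minor arcs `[0, 1] \ M`. -/
def minorArcs (P Q : ℝ) : Set ℝ :=
  Set.Icc (0 : ℝ) 1 \ majorArcs P Q

/-- The weighted exponential sum `∑_{n ≤ N} τ(n) e(f(n))`, with `τ(n)` the number of divisors. -/
noncomputable def divisorExpSum (f : Polynomial ℝ) (N : ℕ) : ℂ :=
  ∑ n ∈ Finset.Icc 1 N, (n.divisors.card : ℂ) * expTwoPiI (f.eval (n : ℝ))

/-- The exponent `γ = 4 ^ (1 - k)`. -/
noncomputable def weylGamma (k : ℕ) : ℝ :=
  (4 : ℝ) ^ (1 - (k : ℝ))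

/-! By the hyperbola method the sum is, up to at most √N diagonal terms, twice the sum over x ≤ √N
of S_x = Σ e(f(xy)), x < y ≤ N/x. Take x in [X, 2X), Y = ⌊N/X⌋, K = 2^(k-1), and write ‖·‖ for the
distance to the nearest integer. As a polynomial in y, f(xy) has leading coefficient αx^k, so Weyl
differencing bounds |S_x|^K by Y^(K-k) times Y^(k-1) plus the sum of min(Y, 1/‖αx^k m‖) over m ≪
Y^(k-1), up to N^ε. A Dirichlet approximation to αx^k with denominator r_x ≤ Y^k/t turns this into
|S_x|^K ≪ Y^K N^ε (1/t + 1/r_x).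

It remains to show that 1/r_x is ≪ N^ε/t on average over x. Since ‖α r_x x^k‖ ≤ t/Y^k, it suffices
that at most RXN^ε/t pairs (r, x) with r ≤ R satisfy ‖α r x^k‖ ≤ t/Y^k. Here the minor arcs enter:
they give a reduced a/q near α with √N < q ≤ N. The integers r x^k are too sparse to be counted
directly, so the set of x is differenced: its points are isolated at scale w, or come in pairs x, x
+ h with h < w, and subtracting lowers the degree. With windows t, t², t⁴, ... one reaches, after j
steps, integers n ≤ M ≍ R t^(2^j-1) X^(k-j) with αn near an integer, each with few representations.
The spacing of the multiples of α bounds their number by (M/q + 1)(qδ + 1), up to constants, with δ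
≍ t/Y^k, and j is chosen so that Mt ≪ RX t^K. The requirement t^K ≤ √N < q dictates t ≍ N^(2^-k);
the K-th root of 1/t is then N^(-γ/2).

The weight is carried by `card_distInt_le`, `norm_sum_pow_le_weylMajorant`, `weylMajorant_le`,
`card_le_of_distInt_le` and `WeylSetup.sum_card_distInt_le`. -/

/-! ### Spacing of the multiples of α modulo 1 -/

/-- The distance from a real number to the nearest integer. -/
noncomputable def distInt (x : ℝ) : ℝ := |x - round x|

lemma distInt_nonneg (x : ℝ) : 0 ≤ distInt x := abs_nonneg _

lemma distInt_le_abs_sub (x : ℝ) (z : ℤ) : distInt x ≤ |x - z| := round_le x z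

lemma distInt_le_half (x : ℝ) : distInt x ≤ 1 / 2 := abs_sub_round x

lemma distInt_sub_le (x y : ℝ) : distInt (x - y) ≤ distInt x + distInt y := by
  calc distInt (x - y) ≤ |x - y - ((round x - round y : ℤ) : ℝ)| := distInt_le_abs_sub _ _
    _ = |(x - round x) - (y - round y)| := by push_cast; ring_nf
    _ ≤ _ := abs_sub _ _

lemma distInt_neg (x : ℝ) : distInt (-x) = distInt x := by
  have key : ∀ y : ℝ, distInt (-y) ≤ distInt y := fun y ↦ by
    refine (distInt_le_abs_sub _ (-round y)).trans (le_of_eq ?_)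
    rw [distInt, ← abs_neg]; push_cast; ring_nf
  exact le_antisymm (key x) (by simpa using key (-x))

/-- `min (Y, 1 / ‖β‖)`, with the value `Y` at integers. -/
noncomputable def recipMin (Y : ℕ) (β : ℝ) : ℝ := Y / max 1 (Y * distInt β)

lemma recipMin_nonneg (Y : ℕ) (β : ℝ) : 0 ≤ recipMin Y β := by
  unfold recipMin; positivity

lemma recipMin_le (Y : ℕ) (β : ℝ) : recipMin Y β ≤ Y :=
  div_le_self (Nat.cast_nonneg _) (le_max_left _ _)

lemma recipMin_neg (Y : ℕ) (β : ℝ) : recipMin Y (-β) = recipMin Y β := by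
  simp [recipMin, distInt_neg]

lemma recipMin_mul_distInt_le (Y : ℕ) (β : ℝ) : recipMin Y β * distInt β ≤ 1 := by
  rw [recipMin, div_mul_eq_mul_div, div_le_one (by positivity)]
  exact le_max_right _ _

lemma le_recipMin {Y : ℕ} {β a : ℝ} (hY : a ≤ Y) (h : a * distInt β ≤ 1) : a ≤ recipMin Y β := by
  have hpos : (0 : ℝ) < max 1 (Y * distInt β) := by positivity
  rw [recipMin, le_div_iff₀ hpos]
  rcases le_total (1 : ℝ) (Y * distInt β) with h' | h'
  · rw [max_eq_right h']
    nlinarith [(Nat.cast_nonneg Y : (0 : ℝ) ≤ Y)]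
  · rw [max_eq_left h']; linarith

/-- If `α` is close to the reduced fraction `a / q`, then small multiples of `α` stay away from
the integers. -/
lemma inv_two_mul_le_distInt {α : ℝ} {a : ℤ} {q : ℕ} (hq : 0 < q) (hc : IsCoprime a (q : ℤ))
    (h : |α - a / q| ≤ 1 / (q : ℝ) ^ 2) {s : ℕ} (hs : 0 < s) (hsq : 2 * s ≤ q) :
    1 / (2 * (q : ℝ)) ≤ distInt (α * s) := by
  have hq' : (0 : ℝ) < q := by exact_mod_cast hq
  set z := round (α * s) with hz
  have hne : a * s - z * q ≠ 0 := by
    intro h0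
    have hdvd : (q : ℤ) ∣ a * s := ⟨z, by linarith⟩
    have := hc.symm.dvd_of_dvd_mul_left hdvd
    have := Nat.le_of_dvd hs (by exact_mod_cast this)
    omega
  have h1 : (1 : ℝ) ≤ |(a : ℝ) * s - z * q| := by
    have := Int.one_le_abs hne
    exact_mod_cast this
  have h2 : 1 / (q : ℝ) ≤ |(a : ℝ) / q * s - z| := by
    have : (a : ℝ) / q * s - z = ((a : ℝ) * s - z * q) / q := by field_simp
    rw [this, abs_div, abs_of_pos hq']
    gcongr
  have h3 : |(α - a / q) * s| ≤ 1 / (2 * q) := by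
    rw [abs_mul, abs_of_nonneg (Nat.cast_nonneg s : (0 : ℝ) ≤ s)]
    have hs' : (s : ℝ) ≤ q / 2 := by
      have : (2 * s : ℝ) ≤ q := by exact_mod_cast hsq
      linarith
    calc |α - a / q| * s ≤ 1 / (q : ℝ) ^ 2 * (q / 2) := by gcongr
      _ = 1 / (2 * q) := by field_simp
  have h4 : |(a : ℝ) / q * s - z| ≤ |α * s - z| + |(α - a / q) * s| := by
    have : (a : ℝ) / q * s - z = (α * s - z) - (α - a / q) * s := by ring
    rw [this]; exact abs_sub _ _
  have h5 : 1 / (q : ℝ) = 1 / (2 * q) + 1 / (2 * q) := by field_simp; norm_num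
  unfold distInt
  rw [← hz]
  linarith

/-- The number of `n ≤ M` for which `α n` is within `δ` of an integer. -/
lemma card_distInt_le {α : ℝ} {a : ℤ} {q : ℕ} (hq : 0 < q) (hc : IsCoprime a (q : ℤ))
    (h : |α - a / q| ≤ 1 / (q : ℝ) ^ 2) {δ : ℝ} (hδ : 0 ≤ δ) (M : ℕ) :
    (((Finset.Icc 1 M).filter fun n : ℕ ↦ distInt (α * n) ≤ δ).card : ℝ) ≤
      (2 * M / q + 1) * (4 * q * δ + 3) := by
  have hq' : (0 : ℝ) < q := by exact_mod_cast hq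
  -- Blocks of length ⌈q/2⌉: distinct points of one block differ by some s with 2s ≤ q, so their
  -- signed residues `u` are at least 1/(2q) apart and fall into different cells of that length.
  set b := (q + 1) / 2 with hb
  have hb0 : 0 < b := by omega
  set u : ℕ → ℝ := fun n ↦ α * n - round (α * n) with hu
  set T := Finset.range (M / b + 1) ×ˢ Finset.Icc ⌊-(2 * q * δ)⌋ ⌊2 * q * δ⌋ with hT
  have hcard : ((Finset.Icc 1 M).filter fun n : ℕ ↦ distInt (α * n) ≤ δ).card ≤ T.card := by
    refine Finset.card_le_card_of_injOn (fun n ↦ (n / b, ⌊2 * q * u n⌋)) ?_ ?_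
    · intro n hn
      simp only [Finset.coe_filter, Finset.mem_Icc, Set.mem_ofPred_eq] at hn
      have hun : |u n| ≤ δ := hn.2
      rw [abs_le] at hun
      simp only [hT, Finset.coe_product, Set.mem_prod, Finset.mem_coe, Finset.mem_range,
        Finset.mem_Icc]
      refine ⟨Nat.lt_succ_of_le (Nat.div_le_div_right hn.1.2), Int.floor_le_floor ?_,
        Int.floor_le_floor ?_⟩ <;> nlinarith
    · have key : ∀ m n : ℕ, m < n → m / b = n / b → ⌊2 * q * u m⌋ = ⌊2 * q * u n⌋ → False := by
        intro m n hmn hd hf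
        have hlt := Int.abs_sub_lt_one_of_floor_eq_floor hf
        obtain ⟨s, rfl⟩ := Nat.exists_eq_add_of_lt hmn
        have h1 := Nat.div_add_mod m b
        have h2 := Nat.div_add_mod (m + s + 1) b
        have h3 := Nat.mod_lt (m + s + 1) hb0
        rw [← hd] at h2
        have hsb : s + 1 < b := by omega
        have := inv_two_mul_le_distInt hq hc h (s := s + 1) (by omega) (by omega)
        have h4 := distInt_le_abs_sub (α * (s + 1 : ℕ)) (round (α * (m + s + 1 : ℕ)) - round (α * m))
        have h5 : α * (s + 1 : ℕ) - ((round (α * (m + s + 1 : ℕ)) - round (α * m) : ℤ) : ℝ) =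
            -(u m - u (m + s + 1)) := by
          simp only [hu]; push_cast; ring
        rw [h5, abs_neg] at h4
        rw [← mul_sub, abs_mul, abs_of_pos (by positivity : (0 : ℝ) < 2 * q)] at hlt
        have h6 : 1 / (2 * (q : ℝ)) ≤ |u m - u (m + s + 1)| := this.trans h4
        rw [div_le_iff₀ (by positivity)] at h6
        linarith
      intro m _ n _ hmn
      simp only [Prod.mk.injEq] at hmn
      rcases lt_trichotomy m n with hlt | heq | hgt
      · exact (key m n hlt hmn.1 hmn.2).elim
      · exact heq
      · exact (key n m hgt hmn.1.symm hmn.2.symm).elim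
  have hT' : (T.card : ℝ) ≤ (2 * M / q + 1) * (4 * q * δ + 3) := by
    rw [hT, Finset.card_product, Finset.card_range, Int.card_Icc]
    have h1 : ((M / b + 1 : ℕ) : ℝ) ≤ 2 * M / q + 1 := by
      have hb' : (q : ℝ) / 2 ≤ b := by
        have : q ≤ 2 * b := by omega
        have : (q : ℝ) ≤ 2 * b := by exact_mod_cast this
        linarith
      have : ((M / b : ℕ) : ℝ) ≤ 2 * M / q := by
        calc ((M / b : ℕ) : ℝ) ≤ M / b := Nat.cast_div_le
          _ ≤ M / (q / 2) := by gcongr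
          _ = 2 * M / q := by field_simp
      push_cast; linarith
    have h2 : ((⌊2 * q * δ⌋ + 1 - ⌊-(2 * q * δ)⌋).toNat : ℝ) ≤ 4 * q * δ + 3 := by
      have hfl : ⌊-(2 * q * δ)⌋ ≤ ⌊2 * q * δ⌋ := Int.floor_le_floor (by
        have : 0 ≤ 2 * q * δ := by positivity
        linarith)
      have : (((⌊2 * q * δ⌋ + 1 - ⌊-(2 * q * δ)⌋).toNat : ℤ) : ℝ) =
          ((⌊2 * q * δ⌋ + 1 - ⌊-(2 * q * δ)⌋ : ℤ) : ℝ) := by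
        rw [Int.toNat_of_nonneg (by omega)]
      rw [← Int.cast_natCast, this]
      push_cast
      linarith [Int.floor_le (2 * q * δ), Int.lt_floor_add_one (-(2 * q * δ))]
    push_cast at h1 h2 ⊢
    gcongr
  exact (by exact_mod_cast hcard : (_ : ℝ) ≤ T.card).trans hT'

/-- If 2^i < A ≤ 2^(i+1), then A d ≤ 1 forces d ≤ 2^(-i), and the term of index i alone dominates A;
d ≤ 1 covers A ≤ 2. -/
lemma le_sum_two_pow_indicator {d A : ℝ} (hd1 : d ≤ 1) (hA : A * d ≤ 1) (L : ℕ)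
    (hL : A ≤ 2 ^ (L + 1)) :
    A ≤ ∑ i ∈ Finset.range (L + 1), 2 ^ (i + 1) * (if d ≤ (1 / 2) ^ i then 1 else 0) := by
  induction L with
  | zero => simp [hd1] at hL ⊢; exact hL
  | succ L ih =>
    rw [Finset.sum_range_succ]
    rcases le_or_gt A (2 ^ (L + 1)) with h | h
    · have := ih h
      have h0 : (0 : ℝ) ≤ 2 ^ (L + 1 + 1) * (if d ≤ (1 / 2) ^ (L + 1) then 1 else 0) := by
        positivity
      linarith
    · have hd : d ≤ (1 / 2) ^ (L + 1) := by
        by_contra hcon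
        push Not at hcon
        have h1 : (1 / 2 : ℝ) ^ (L + 1) * 2 ^ (L + 1) = 1 := by
          rw [← mul_pow]; norm_num
        have h2 : (0 : ℝ) < 2 ^ (L + 1) := by positivity
        have h3 : (0 : ℝ) < (1 / 2 : ℝ) ^ (L + 1) := by positivity
        nlinarith
      rw [if_pos hd, mul_one]
      have : 0 ≤ ∑ i ∈ Finset.range (L + 1), (2 : ℝ) ^ (i + 1) *
          (if d ≤ (1 / 2) ^ i then 1 else 0) := Finset.sum_nonneg fun i _ ↦ by positivity
      linarith

/-- Points where `recipMin` has size about 2^i lie within 2^(-i) of an integer, so `card_distInt_le`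
counts them. Such a layer costs ≪ (M/r + 1)(r + 2^i), and there are about log Y layers. -/
lemma sum_recipMin_le {β : ℝ} {b : ℤ} {r : ℕ} (hr : 0 < r) (hc : IsCoprime b (r : ℤ))
    (h : |β - b / r| ≤ 1 / (r : ℝ) ^ 2) {Y : ℕ} (hY : 0 < Y) (M : ℕ) :
    ∑ m ∈ Finset.Icc 1 M, recipMin Y (β * m) ≤
      12 * (Nat.log 2 Y + 1) * (2 * M / r + 1) * (r + Y) := by
  set L := Nat.log 2 Y with hLdef
  have hr' : (0 : ℝ) < r := by exact_mod_cast hr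
  have hpt : ∀ m : ℕ, recipMin Y (β * m) ≤
      ∑ i ∈ Finset.range (L + 1), 2 ^ (i + 1) * (if distInt (β * m) ≤ (1 / 2) ^ i then 1 else 0) := by
    intro m
    refine le_sum_two_pow_indicator ((distInt_le_half _).trans (by norm_num))
      (recipMin_mul_distInt_le _ _) L ((recipMin_le _ _).trans ?_)
    exact_mod_cast (Nat.lt_pow_succ_log_self (by norm_num) Y).le
  have hL2 : (2 : ℝ) ^ L ≤ Y := by
    exact_mod_cast Nat.pow_log_le_self 2 hY.ne'
  have hsum2 : ∑ i ∈ Finset.range (L + 1), (2 : ℝ) ^ i ≤ 2 * 2 ^ L := by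
    rw [geom_sum_eq (by norm_num)]
    rw [pow_succ]; norm_num; linarith
  calc ∑ m ∈ Finset.Icc 1 M, recipMin Y (β * m)
      ≤ ∑ m ∈ Finset.Icc 1 M, ∑ i ∈ Finset.range (L + 1),
          2 ^ (i + 1) * (if distInt (β * m) ≤ (1 / 2) ^ i then 1 else 0) :=
        Finset.sum_le_sum fun m _ ↦ hpt m
    _ = ∑ i ∈ Finset.range (L + 1), (2 : ℝ) ^ (i + 1) *
          (((Finset.Icc 1 M).filter fun n : ℕ ↦ distInt (β * n) ≤ (1 / 2) ^ i).card : ℝ) := by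
        rw [Finset.sum_comm]
        refine Finset.sum_congr rfl fun i _ ↦ ?_
        rw [← Finset.mul_sum, Finset.card_filter]
        push_cast; rfl
    _ ≤ ∑ i ∈ Finset.range (L + 1), (2 : ℝ) ^ (i + 1) *
          ((2 * M / r + 1) * (4 * r * (1 / 2) ^ i + 3)) :=
        Finset.sum_le_sum fun i _ ↦ mul_le_mul_of_nonneg_left
          (card_distInt_le hr hc h (by positivity) M) (by positivity)
    _ = (2 * M / r + 1) * ∑ i ∈ Finset.range (L + 1), (8 * (r : ℝ) + 6 * 2 ^ i) := by
        rw [Finset.mul_sum]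
        refine Finset.sum_congr rfl fun i _ ↦ ?_
        have : (2 : ℝ) ^ i * (1 / 2) ^ i = 1 := by rw [← mul_pow]; norm_num
        rw [pow_succ]
        linear_combination (2 * M / r + 1) * 8 * r * this
    _ ≤ (2 * M / r + 1) * (12 * (L + 1) * (r + Y)) := by
        refine mul_le_mul_of_nonneg_left ?_ (by positivity)
        rw [Finset.sum_add_distrib, Finset.sum_const, ← Finset.mul_sum, Finset.card_range, nsmul_eq_mul]
        push_cast
        nlinarith [(Nat.cast_nonneg L : (0 : ℝ) ≤ L), (Nat.cast_nonneg Y : (0 : ℝ) ≤ Y),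
          mul_nonneg (Nat.cast_nonneg L : (0 : ℝ) ≤ L) (Nat.cast_nonneg Y : (0 : ℝ) ≤ Y),
          mul_nonneg (Nat.cast_nonneg L : (0 : ℝ) ≤ L) hr'.le]
    _ = _ := by ring

/-! ### Divisor bound -/

/-- The divisor bound `τ(n) ≪ n ^ ε`. -/
lemma exists_card_divisors_le_rpow {ε : ℝ} (hε : 0 < ε) :
    ∃ C : ℝ, 1 ≤ C ∧ ∀ n : ℕ, n ≠ 0 → (n.divisors.card : ℝ) ≤ C * (n : ℝ) ^ ε := by
  set K : ℝ := 1 + 1 / (ε * Real.log 2) with hK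
  have hl2 : 0 < Real.log 2 := Real.log_pos (by norm_num)
  have hK1 : 1 ≤ K := by rw [hK]; have : 0 < 1 / (ε * Real.log 2) := by positivity
                         linarith
  set P : ℕ := ⌈(2 : ℝ) ^ (1 / ε)⌉₊ with hP
  refine ⟨K ^ P, one_le_pow₀ hK1, fun n hn ↦ ?_⟩
  -- Each prime below `P` may cost a factor `K`, because v + 1 ≤ K(1 + vε log 2) ≤ K p^(vε). A
  -- larger prime has p^ε ≥ 2, and v + 1 ≤ 2^v costs nothing.
  have hterm : ∀ p ∈ n.primeFactors, ((n.factorization p + 1 : ℕ) : ℝ) ≤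
      (if p < P then K else 1) * ((p : ℝ) ^ n.factorization p) ^ ε := by
    intro p hp
    have hp2 : 2 ≤ p := (Nat.prime_of_mem_primeFactors hp).two_le
    set v := n.factorization p
    have hp2' : (2 : ℝ) ≤ p := by exact_mod_cast hp2
    split_ifs with hpP
    · have h1 : (2 : ℝ) ^ ((v : ℝ) * ε) ≤ ((p : ℝ) ^ v) ^ ε := by
        rw [Real.rpow_mul (by norm_num), Real.rpow_natCast]
        gcongr
      have h2 : 1 + v * ε * Real.log 2 ≤ (2 : ℝ) ^ ((v : ℝ) * ε) := by
        rw [Real.rpow_def_of_pos (by norm_num)]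
        have := Real.add_one_le_exp (Real.log 2 * (v * ε))
        linarith
      have h3 : ((v + 1 : ℕ) : ℝ) ≤ K * (1 + v * ε * Real.log 2) := by
        have : K * (1 + v * ε * Real.log 2) =
            1 + v + v * ε * Real.log 2 + 1 / (ε * Real.log 2) := by
          rw [hK]; field_simp; ring
        rw [this]; push_cast
        have : 0 ≤ v * ε * Real.log 2 := by positivity
        have : 0 ≤ 1 / (ε * Real.log 2) := by positivity
        linarith
      calc _ ≤ _ := h3
        _ ≤ _ := by gcongr; exact h2.trans h1
    · have hpε : 2 ≤ (p : ℝ) ^ ε := by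
        have : (2 : ℝ) ^ (1 / ε) ≤ p := by
          calc _ ≤ ((P : ℕ) : ℝ) := Nat.le_ceil _
            _ ≤ p := by exact_mod_cast not_lt.mp hpP
        calc (2 : ℝ) = ((2 : ℝ) ^ (1 / ε)) ^ ε := by
              rw [← Real.rpow_mul (by norm_num)]; field_simp; simp
          _ ≤ (p : ℝ) ^ ε := by gcongr
      have h1 : ((p : ℝ) ^ v) ^ ε = ((p : ℝ) ^ ε) ^ v := by
        rw [← Real.rpow_natCast, ← Real.rpow_natCast, ← Real.rpow_mul (by positivity),
          ← Real.rpow_mul (by positivity), mul_comm]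
      rw [one_mul, h1]
      calc ((v + 1 : ℕ) : ℝ) ≤ (2 : ℝ) ^ v := by
            exact_mod_cast Nat.lt_two_pow_self
        _ ≤ _ := by gcongr
  have hprod : ∏ p ∈ n.primeFactors, (if p < P then K else 1) ≤ K ^ P := by
    rw [Finset.prod_ite, Finset.prod_const, Finset.prod_const_one, mul_one]
    refine pow_le_pow_right₀ hK1 ?_
    calc _ ≤ (Finset.range P).card := Finset.card_le_card fun p hp ↦ by
          simpa using (Finset.mem_filter.mp hp).2
      _ = P := Finset.card_range P
  have hn' : ∏ p ∈ n.primeFactors, ((p : ℝ) ^ n.factorization p) ^ ε = (n : ℝ) ^ ε := by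
    rw [Real.finsetProd_rpow _ _ (fun _ _ ↦ by positivity)]
    congr 1
    conv_rhs => rw [← Nat.prod_factorization_pow_eq_self hn]
    rw [Finsupp.prod]; push_cast; rfl
  rw [Nat.card_divisors hn]
  push_cast at hterm ⊢
  calc _ ≤ ∏ p ∈ n.primeFactors, (if p < P then K else 1) * ((p : ℝ) ^ n.factorization p) ^ ε :=
        Finset.prod_le_prod (fun _ _ ↦ by positivity) hterm
    _ = (∏ p ∈ n.primeFactors, (if p < P then K else 1)) * (n : ℝ) ^ ε := by
        rw [Finset.prod_mul_distrib, hn']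
    _ ≤ _ := by gcongr

/-! ### Additive characters and geometric sums -/

lemma expTwoPiI_add (x y : ℝ) : expTwoPiI (x + y) = expTwoPiI x * expTwoPiI y := by
  rw [expTwoPiI, expTwoPiI, expTwoPiI, ← Complex.exp_add]; push_cast; ring_nf

lemma expTwoPiI_eq (x : ℝ) : expTwoPiI x = Complex.exp (Complex.I * ((2 * Real.pi * x : ℝ) : ℂ)) := by
  rw [expTwoPiI]; push_cast; ring_nf

lemma norm_expTwoPiI (x : ℝ) : ‖expTwoPiI x‖ = 1 := by
  rw [expTwoPiI_eq, mul_comm]; exact Complex.norm_exp_ofReal_mul_I _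

lemma expTwoPiI_int (n : ℤ) : expTwoPiI n = 1 := by
  rw [expTwoPiI, ← Complex.exp_int_mul_two_pi_mul_I n]; push_cast; ring_nf

lemma star_expTwoPiI (x : ℝ) : (starRingEnd ℂ) (expTwoPiI x) = expTwoPiI (-x) := by
  rw [expTwoPiI_eq, expTwoPiI_eq, ← Complex.exp_conj, map_mul, Complex.conj_I, Complex.conj_ofReal]
  push_cast; ring_nf

/-- Jordan's inequality applied to |e(β) - 1| = 2|sin πu|, with u the signed distance to the nearest
integer. -/
lemma four_mul_distInt_le (β : ℝ) : 4 * distInt β ≤ ‖expTwoPiI β - 1‖ := by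
  set u := β - round β with hu
  have h1 : expTwoPiI β = expTwoPiI u := by
    have : β = u + (round β : ℤ) := by rw [hu]; ring
    conv_lhs => rw [this]
    rw [expTwoPiI_add, expTwoPiI_int, mul_one]
  have hu2 : |u| ≤ 1 / 2 := abs_sub_round β
  rw [h1, expTwoPiI_eq, Complex.norm_exp_I_mul_ofReal_sub_one, norm_mul, Real.norm_eq_abs,
    Real.norm_eq_abs, abs_of_pos (by norm_num : (0 : ℝ) < 2)]
  have hpi := Real.pi_pos
  have h3 : 2 * Real.pi * u / 2 = Real.pi * u := by ring
  have h4 : |Real.pi * u| = Real.pi * |u| := by rw [abs_mul, abs_of_pos hpi]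
  have := Real.mul_abs_le_abs_sin (x := Real.pi * u) (by rw [h4]; nlinarith)
  rw [h3]
  have h5 : 2 / Real.pi * |Real.pi * u| = 2 * |u| := by rw [h4]; field_simp
  have h6 : distInt β = |u| := rfl
  rw [h6]; linarith

lemma sum_Ico_int_telescope (F : ℤ → ℂ) {a b : ℤ} (hab : a ≤ b) :
    ∑ y ∈ Finset.Ico a b, (F (y + 1) - F y) = F b - F a := by
  induction b, hab using Int.leInduction with
  | base => simp
  | succ n hn ih =>
    have : Finset.Ico a (n + 1) = insert n (Finset.Ico a n) := by ext; simp; omega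
    rw [this, Finset.sum_insert (by simp), ih]; ring

/-- The number of integers in `Ico a b` is at most `Y`. -/
lemma card_Ico_le_of_sub_le {a b : ℤ} {Y : ℕ} (h : b - a ≤ Y) : (Finset.Ico a b).card ≤ Y := by
  rw [Int.card_Ico]; omega

/-- Multiplication by e(β) - 1 telescopes the geometric sum to two unimodular terms. -/
lemma norm_sum_linear_le {c β : ℝ} {a b : ℤ} {Y : ℕ} (h : b - a ≤ Y) :
    ‖∑ y ∈ Finset.Ico a b, expTwoPiI (c + β * y)‖ ≤ recipMin Y β := by
  set S := ∑ y ∈ Finset.Ico a b, expTwoPiI (c + β * y) with hS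
  refine le_recipMin ?_ ?_
  · calc ‖S‖ ≤ ∑ y ∈ Finset.Ico a b, ‖expTwoPiI (c + β * y)‖ := norm_sum_le _ _
      _ = ((Finset.Ico a b).card : ℝ) := by simp [norm_expTwoPiI]
      _ ≤ Y := by exact_mod_cast card_Ico_le_of_sub_le h
  · rcases le_total a b with hab | hab
    · have h1 : S * (expTwoPiI β - 1) = expTwoPiI (c + β * b) - expTwoPiI (c + β * a) := by
        rw [← sum_Ico_int_telescope (fun y : ℤ ↦ expTwoPiI (c + β * y)) hab, hS, Finset.sum_mul]
        refine Finset.sum_congr rfl fun y _ ↦ ?_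
        have : c + β * ((y + 1 : ℤ) : ℝ) = (c + β * y) + β := by push_cast; ring
        simp only [this]
        rw [expTwoPiI_add (c + β * y) β]; ring
      have h2 : ‖S‖ * ‖expTwoPiI β - 1‖ ≤ 2 := by
        rw [← norm_mul, h1]
        refine (norm_sub_le _ _).trans ?_
        rw [norm_expTwoPiI, norm_expTwoPiI]; norm_num
      have h3 := mul_le_mul_of_nonneg_left (four_mul_distInt_le β) (norm_nonneg S)
      nlinarith [mul_nonneg (norm_nonneg S) (distInt_nonneg β)]
    · rw [hS, Finset.Ico_eq_empty (by omega)]; simp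

/-! ### Weyl differencing in y -/

/-- One step of Weyl differencing. -/
lemma norm_sum_sq_le (g : ℤ → ℝ) {a b : ℤ} {Y : ℕ} (h : b - a ≤ Y) :
    ‖∑ y ∈ Finset.Ico a b, expTwoPiI (g y)‖ ^ 2 ≤ ∑ h ∈ Finset.Ioo (-(Y : ℤ)) Y,
      ‖∑ y ∈ Finset.Ico (max a (a - h)) (min b (b - h)), expTwoPiI (g (y + h) - g y)‖ := by
  set I := Finset.Ico a b with hI
  set S := ∑ y ∈ I, expTwoPiI (g y) with hS
  have h1 : ((‖S‖ ^ 2 : ℝ) : ℂ) = ∑ h ∈ Finset.Ioo (-(Y : ℤ)) Y,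
      ∑ y ∈ Finset.Ico (max a (a - h)) (min b (b - h)), expTwoPiI (g (y + h) - g y) := by
    have hstar : (starRingEnd ℂ) S = ∑ y ∈ I, expTwoPiI (-g y) := by
      rw [hS, map_sum]; exact Finset.sum_congr rfl fun y _ ↦ star_expTwoPiI _
    have h2 : ((‖S‖ ^ 2 : ℝ) : ℂ) = (starRingEnd ℂ) S * S := by
      rw [Complex.conj_mul']; push_cast; rfl
    rw [h2, hstar, hS, Finset.sum_mul_sum]
    -- The pairs are grouped by h = x - y; |h| < Y because the interval has at most Y points.
    have h3 : ∀ y ∈ I, ∑ x ∈ I, expTwoPiI (-g y) * expTwoPiI (g x) =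
        ∑ h ∈ Finset.Ioo (-(Y : ℤ)) Y, if y + h ∈ I then expTwoPiI (g (y + h) - g y) else 0 := by
      intro y hy
      rw [← Finset.sum_filter]
      refine Finset.sum_nbij' (fun x ↦ x - y) (fun h ↦ y + h) ?_ ?_ ?_ ?_ ?_
      · intro x hx; simp [hI] at hx hy ⊢; omega
      · intro x hx; simp only [Finset.mem_filter] at hx; exact hx.2
      · intro x _; simp
      · intro x _; simp
      · intro x _
        rw [← expTwoPiI_add]; congr 1; simp; ring
    rw [Finset.sum_congr rfl h3, Finset.sum_comm]
    refine Finset.sum_congr rfl fun h _ ↦ ?_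
    rw [← Finset.sum_filter]
    refine Finset.sum_congr ?_ fun _ _ ↦ rfl
    ext y; simp [hI]; omega
  have h2 : ‖S‖ ^ 2 = ‖((‖S‖ ^ 2 : ℝ) : ℂ)‖ := by
    rw [Complex.norm_real, Real.norm_of_nonneg (by positivity)]
  rw [h2, h1]
  exact norm_sum_le _ _

/-- The majorant that `k` steps of Weyl differencing give for a polynomial of degree `k + 1`. -/
noncomputable def weylMajorant (Y : ℕ) : ℕ → ℝ → ℝ
  | 0, β => recipMin Y β
  | k + 1, β => ∑ h ∈ Finset.Ioo (-(Y : ℤ)) Y, weylMajorant Y k ((k + 2) * β * h)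

-- Only a degree bound and the coefficient in top position are kept: for h = 0 the difference
-- vanishes, so an exact degree would not survive the induction.
open Polynomial in
lemma natDegree_taylor_sub_le {f : ℝ[X]} {k : ℕ} (hf : f.natDegree ≤ k + 1) (h : ℝ) :
    (taylor h f - f).natDegree ≤ k ∧ (taylor h f - f).coeff k = (k + 1) * f.coeff (k + 1) * h := by
  have hco : ∀ n, (taylor h f).coeff n = (hasseDeriv n f).eval h := fun n ↦ taylor_coeff _ _ _
  have hd : ∀ n, (hasseDeriv n f).natDegree ≤ k + 1 - n := fun n ↦
    (natDegree_hasseDeriv_le f n).trans (by omega)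
  constructor
  · rw [natDegree_le_iff_coeff_eq_zero]
    intro n hn
    rcases Nat.lt_or_ge (k + 1) n with hlt | hge
    · rw [coeff_sub, coeff_eq_zero_of_natDegree_lt (p := f) (by omega),
        coeff_eq_zero_of_natDegree_lt (by rw [natDegree_taylor]; omega), sub_zero]
    · obtain rfl : n = k + 1 := by omega
      have h0 := hd (k + 1)
      rw [coeff_sub, hco, eq_C_of_natDegree_le_zero (p := hasseDeriv (k + 1) f) (by omega), eval_C,
        hasseDeriv_coeff]
      simp
  · have h0 := hd k
    rw [coeff_sub, hco, eval_eq_sum_range' (n := 2) (by omega), Finset.sum_range_succ,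
      Finset.sum_range_one, hasseDeriv_coeff, hasseDeriv_coeff, add_comm 1 k]
    simp

open Polynomial in
/-- Weyl's inequality, before the evaluation of the majorant. -/
lemma norm_sum_pow_le_weylMajorant (Y k : ℕ) : ∀ {f : ℝ[X]}, f.natDegree ≤ k + 1 → ∀ {a b : ℤ},
    b - a ≤ Y → ‖∑ y ∈ Finset.Ico a b, expTwoPiI (f.eval (y : ℝ))‖ ^ 2 ^ k ≤
      (2 * Y : ℝ) ^ (2 ^ k - (k + 1)) * weylMajorant Y k (f.coeff (k + 1)) := by
  induction k with
  | zero =>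
    intro f hf a b hab
    have : ∀ y : ℤ, f.eval (y : ℝ) = f.coeff 0 + f.coeff 1 * y := by
      intro y
      rw [eval_eq_sum_range' (n := 2) (by omega), Finset.sum_range_succ, Finset.sum_range_one]
      simp
    simp only [this, pow_zero, pow_one, zero_add, Nat.sub_self, one_mul]
    exact norm_sum_linear_le hab
  | succ k ih =>
    intro f hf a b hab
    rcases Nat.eq_zero_or_pos Y with rfl | hY
    · rw [Finset.Ico_eq_empty (by simp at hab; omega)]
      simp [weylMajorant]
    set J := Finset.Ioo (-(Y : ℤ)) Y with hJ
    set T : ℤ → ℝ := fun h ↦ ‖∑ y ∈ Finset.Ico (max a (a - h)) (min b (b - h)),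
      expTwoPiI (f.eval ((y + h : ℤ) : ℝ) - f.eval (y : ℝ))‖ with hT
    have hJcard : (J.card : ℝ) ≤ 2 * Y := by
      have : J.card ≤ 2 * Y := by rw [hJ, Int.card_Ioo]; omega
      exact_mod_cast this
    have hTle : ∀ h ∈ J, T h ^ 2 ^ k ≤ (2 * Y : ℝ) ^ (2 ^ k - (k + 1)) *
        weylMajorant Y k ((k + 2) * f.coeff (k + 2) * h) := by
      intro h _
      obtain ⟨hdeg, hcoeff⟩ := natDegree_taylor_sub_le (k := k + 1) hf (h : ℝ)
      have := ih hdeg (a := max a (a - h)) (b := min b (b - h)) (by omega)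
      rw [hcoeff] at this
      simp only [eval_sub, taylor_eval] at this
      simp only [hT]
      push_cast at this ⊢
      rw [show (k : ℝ) + 2 = k + 1 + 1 by ring]
      exact this
    have hsq : ‖∑ y ∈ Finset.Ico a b, expTwoPiI (f.eval (y : ℝ))‖ ^ 2 ≤ ∑ h ∈ J, T h :=
      norm_sum_sq_le (fun y ↦ f.eval (y : ℝ)) hab
    obtain ⟨m, hm⟩ : ∃ m, 2 ^ k = m + 1 := Nat.exists_eq_succ_of_ne_zero (by positivity)
    have hk2 : k + 1 ≤ 2 ^ k := Nat.lt_two_pow_self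
    have hexp : m + (2 ^ k - (k + 1)) = 2 ^ (k + 1) - (k + 1 + 1) := by
      rw [pow_succ]; omega
    calc ‖∑ y ∈ Finset.Ico a b, expTwoPiI (f.eval (y : ℝ))‖ ^ 2 ^ (k + 1)
        = (‖∑ y ∈ Finset.Ico a b, expTwoPiI (f.eval (y : ℝ))‖ ^ 2) ^ 2 ^ k := by
          rw [← pow_mul, pow_succ, mul_comm]
      _ ≤ (∑ h ∈ J, T h) ^ 2 ^ k := by gcongr
      -- Power mean inequality, with m = 2^k - 1.
      _ ≤ (J.card : ℝ) ^ m * ∑ h ∈ J, T h ^ 2 ^ k := by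
          rw [hm]
          exact pow_sum_le_card_mul_sum_pow (fun h _ ↦ norm_nonneg _) m
      _ ≤ (2 * Y : ℝ) ^ m * ∑ h ∈ J, ((2 * Y : ℝ) ^ (2 ^ k - (k + 1)) *
            weylMajorant Y k ((k + 2) * f.coeff (k + 2) * h)) := by
          gcongr with h hh
          exact hTle h hh
      _ = _ := by
          rw [← Finset.mul_sum, ← mul_assoc, ← pow_add, hexp]
          simp only [weylMajorant]
          rfl

/-! ### Evaluation of the Weyl majorant -/

/-- After interchanging the sums, each n is counted once for every divisor in `s`, hence at most D
times. -/
lemma sum_sum_dvd_le {F : ℕ → ℝ} (hF : ∀ n, 0 ≤ F n) {M : ℕ} {D : ℝ}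
    (hD : ∀ n ∈ Finset.Icc 1 M, (n.divisors.card : ℝ) ≤ D) (s : Finset ℕ) :
    ∑ h ∈ s, ∑ n ∈ (Finset.Icc 1 M).filter (h ∣ ·), F n ≤ D * ∑ n ∈ Finset.Icc 1 M, F n := by
  simp only [Finset.sum_filter]
  rw [Finset.sum_comm, Finset.mul_sum]
  refine Finset.sum_le_sum fun n hn ↦ ?_
  rw [← Finset.sum_filter, Finset.sum_const, nsmul_eq_mul]
  refine mul_le_mul_of_nonneg_right (le_trans ?_ (hD n hn)) (hF n)
  have hn0 : n ≠ 0 := by simp at hn; omega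
  exact_mod_cast Finset.card_le_card fun h hh ↦
    Nat.mem_divisors.mpr ⟨(Finset.mem_filter.mp hh).2, hn0⟩

lemma sum_sum_mul_le {F : ℕ → ℝ} (hF : ∀ n, 0 ≤ F n) {M : ℕ} {D : ℝ}
    (hD : ∀ n ∈ Finset.Icc 1 M, (n.divisors.card : ℝ) ≤ D) {A B c : ℕ} (hc : 0 < c)
    (hM : c * A * B ≤ M) :
    ∑ h ∈ Finset.Icc 1 A, ∑ m ∈ Finset.Icc 1 B, F (c * h * m) ≤
      D * ∑ n ∈ Finset.Icc 1 M, F n := by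
  refine le_trans (Finset.sum_le_sum fun h hh ↦ ?_) (sum_sum_dvd_le hF hD (Finset.Icc 1 A))
  simp only [Finset.mem_Icc] at hh
  have hinj : Set.InjOn (fun m ↦ c * h * m) (Finset.Icc 1 B) := fun x _ y _ hxy ↦
    Nat.eq_of_mul_eq_mul_left (Nat.mul_pos hc hh.1) hxy
  rw [← Finset.sum_image (f := F) hinj]
  refine Finset.sum_le_sum_of_subset_of_nonneg (fun n hn ↦ ?_) fun n _ _ ↦ hF n
  obtain ⟨m, hm, rfl⟩ := Finset.mem_image.mp hn
  simp only [Finset.mem_Icc] at hm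
  simp only [Finset.mem_filter, Finset.mem_Icc]
  refine ⟨⟨Nat.mul_pos (Nat.mul_pos hc hh.1) hm.1, le_trans ?_ hM⟩, ⟨c * m, by ring⟩⟩
  exact Nat.mul_le_mul (Nat.mul_le_mul_left c hh.2) hm.2

lemma sum_Ioo_even (G : ℤ → ℝ) (hG : ∀ h, G (-h) = G h) (n : ℕ) :
    ∑ h ∈ Finset.Ioo (-((n + 1 : ℕ) : ℤ)) (n + 1 : ℕ), G h =
      G 0 + 2 * ∑ h ∈ Finset.Icc 1 n, G (h : ℕ) := by
  induction n with
  | zero =>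
    have : Finset.Ioo (-((0 + 1 : ℕ) : ℤ)) (0 + 1 : ℕ) = {0} := by ext; simp; omega
    rw [this]; simp
  | succ n ih =>
    have : Finset.Ioo (-((n + 1 + 1 : ℕ) : ℤ)) (n + 1 + 1 : ℕ) =
        insert (((n + 1 : ℕ)) : ℤ) (insert (-((n + 1 : ℕ) : ℤ))
          (Finset.Ioo (-((n + 1 : ℕ) : ℤ)) (n + 1 : ℕ))) := by
      ext; simp; omega
    rw [this, Finset.sum_insert (by simp; omega), Finset.sum_insert (by simp), ih, hG,
      Finset.sum_Icc_succ_top (by omega)]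
    ring

lemma weylMajorant_neg (Y k : ℕ) : ∀ β, weylMajorant Y k (-β) = weylMajorant Y k β := by
  induction k with
  | zero => exact recipMin_neg Y
  | succ k ih =>
    intro β
    refine Finset.sum_congr rfl fun h _ ↦ ?_
    rw [← ih]; congr 1; ring

lemma weylMajorant_le_trivial (Y k : ℕ) : ∀ β, weylMajorant Y k β ≤ (2 * Y : ℝ) ^ k * Y := by
  induction k with
  | zero => intro β; simpa [weylMajorant] using recipMin_le Y β
  | succ k ih =>
    intro β
    have hc : ((Finset.Ioo (-(Y : ℤ)) Y).card : ℝ) ≤ 2 * Y := by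
      have : (Finset.Ioo (-(Y : ℤ)) Y).card ≤ 2 * Y := by rw [Int.card_Ioo]; omega
      exact_mod_cast this
    calc weylMajorant Y (k + 1) β ≤ ∑ h ∈ Finset.Ioo (-(Y : ℤ)) Y, (2 * Y : ℝ) ^ k * Y :=
          Finset.sum_le_sum fun h _ ↦ ih _
      _ = (Finset.Ioo (-(Y : ℤ)) Y).card * ((2 * Y : ℝ) ^ k * Y) := by simp
      _ ≤ 2 * Y * ((2 * Y : ℝ) ^ k * Y) := by gcongr
      _ = _ := by ring

/-- Terms with h = 0 are bounded trivially and give the first summand. The others involve β times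
(k+1)! h₁⋯h_k; the product is built up one factor at a time, each at the cost of D for multiplicity
and 2 for the sign of h. -/
lemma weylMajorant_le {Y : ℕ} (hY : 0 < Y) {D : ℝ} (hD1 : 1 ≤ D) (k : ℕ) :
    (∀ n ∈ Finset.Icc 1 ((k + 1).factorial * Y ^ k), (n.divisors.card : ℝ) ≤ D) → ∀ β,
    weylMajorant Y k β ≤ k * 2 ^ k * (Y : ℝ) ^ k +
      (2 * D) ^ k * ∑ m ∈ Finset.Icc 1 ((k + 1).factorial * Y ^ k), recipMin Y (β * m) := by
  induction k with
  | zero => intro _ β; simp [weylMajorant]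
  | succ k ih =>
    intro hD β
    have hmono : (k + 1).factorial * Y ^ k ≤ (k + 1 + 1).factorial * Y ^ (k + 1) :=
      Nat.mul_le_mul (Nat.factorial_le (by omega)) (Nat.pow_le_pow_right hY (by omega))
    have ih' := ih fun n hn ↦ hD n (by simp only [Finset.mem_Icc] at hn ⊢; omega)
    obtain ⟨n, rfl⟩ : ∃ n, Y = n + 1 := ⟨Y - 1, by omega⟩
    set Z := n + 1 with hZ
    have heven := sum_Ioo_even (fun h : ℤ ↦ weylMajorant Z k ((k + 2) * β * h))
      (fun h ↦ by
        show weylMajorant Z k ((k + 2) * β * ((-h : ℤ) : ℝ)) = _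
        rw [← weylMajorant_neg]; congr 1; push_cast; ring) n
    have hterm : ∀ h ∈ Finset.Icc 1 n, weylMajorant Z k ((k + 2) * β * ((h : ℕ) : ℤ)) ≤
        k * 2 ^ k * (Z : ℝ) ^ k + (2 * D) ^ k *
          ∑ m ∈ Finset.Icc 1 ((k + 1).factorial * Z ^ k), recipMin Z (β * (((k + 2) * h * m : ℕ))) := by
      intro h _
      refine (ih' _).trans (le_of_eq ?_)
      congr 2
      refine Finset.sum_congr rfl fun m _ ↦ ?_
      congr 1; push_cast; ring
    have hdouble := sum_sum_mul_le (F := fun m : ℕ ↦ recipMin Z (β * m))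
      (fun _ ↦ recipMin_nonneg _ _) hD (A := n) (B := (k + 1).factorial * Z ^ k) (c := k + 2)
      (by omega) (by
        calc (k + 2) * n * ((k + 1).factorial * Z ^ k) ≤
            (k + 2) * Z * ((k + 1).factorial * Z ^ k) := by gcongr; omega
          _ = (k + 1 + 1).factorial * Z ^ (k + 1) := by rw [Nat.factorial_succ (k + 1)]; ring)
    have hnZ : (n : ℝ) ≤ Z := by exact_mod_cast (by omega : n ≤ Z)
    have h0 : weylMajorant Z k ((k + 2) * β * ((0 : ℤ) : ℝ)) ≤ (2 * Z : ℝ) ^ k * Z :=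
      weylMajorant_le_trivial _ _ _
    set W := ∑ m ∈ Finset.Icc 1 ((k + 1 + 1).factorial * Z ^ (k + 1)), recipMin Z (β * m)
    calc weylMajorant Z (k + 1) β
        = weylMajorant Z k ((k + 2) * β * ((0 : ℤ) : ℝ)) +
          2 * ∑ h ∈ Finset.Icc 1 n, weylMajorant Z k ((k + 2) * β * ((h : ℕ) : ℤ)) := heven
      _ ≤ (2 * Z : ℝ) ^ k * Z + 2 * ∑ h ∈ Finset.Icc 1 n, (k * 2 ^ k * (Z : ℝ) ^ k + (2 * D) ^ k *
          ∑ m ∈ Finset.Icc 1 ((k + 1).factorial * Z ^ k),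
            recipMin Z (β * (((k + 2) * h * m : ℕ)))) := by
          gcongr with h hh
          exact hterm h hh
      _ = (2 * Z : ℝ) ^ k * Z + 2 * (n * (k * 2 ^ k * (Z : ℝ) ^ k)) + 2 * (2 * D) ^ k *
          ∑ h ∈ Finset.Icc 1 n, ∑ m ∈ Finset.Icc 1 ((k + 1).factorial * Z ^ k),
            recipMin Z (β * (((k + 2) * h * m : ℕ))) := by
          rw [Finset.sum_add_distrib, Finset.sum_const, Nat.card_Icc, Nat.add_sub_cancel,
            nsmul_eq_mul, ← Finset.mul_sum]
          ring
      _ ≤ (2 * Z : ℝ) ^ k * Z + 2 * (Z * (k * 2 ^ k * (Z : ℝ) ^ k)) +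
          2 * (2 * D) ^ k * (D * W) := by gcongr
      _ = (2 * k + 1) * 2 ^ k * (Z : ℝ) ^ (k + 1) + (2 * D) ^ (k + 1) * W := by
          rw [mul_pow]; ring
      _ ≤ _ := by
          have : (0 : ℝ) ≤ 2 ^ k * (Z : ℝ) ^ (k + 1) := by positivity
          push_cast
          rw [pow_succ (2 : ℝ) k]
          nlinarith

/-! ### Repeated differencing in x -/

/-- A set in a dyadic interval is covered by few points and by pairs of points at distance `< w`. -/
lemma card_le_add_sum_pairs {X w : ℕ} (hw : 0 < w) (hwX : w ≤ X) {S : Finset ℕ}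
    (hS : S ⊆ Finset.Ico X (2 * X)) :
    (S.card : ℝ) ≤ 3 * X / w + ∑ h ∈ Finset.Ico 1 w, ((S.filter (· + h ∈ S)).card : ℝ) := by
  classical
  set S₁ := S.filter fun x ↦ ∃ h ∈ Finset.Ico 1 w, x + h ∈ S with hS₁
  set S₂ := S.filter fun x ↦ ¬ ∃ h ∈ Finset.Ico 1 w, x + h ∈ S with hS₂
  have hsplit : S.card = S₁.card + S₂.card := (Finset.card_filter_add_card_filter_not _).symm
  have h1 : S₁.card ≤ ∑ h ∈ Finset.Ico 1 w, (S.filter (· + h ∈ S)).card := by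
    refine (Finset.card_le_card (t := (Finset.Ico 1 w).biUnion fun h ↦ S.filter (· + h ∈ S))
      fun x hx ↦ ?_).trans Finset.card_biUnion_le
    obtain ⟨hxS, h, hh, hxh⟩ := Finset.mem_filter.mp hx
    exact Finset.mem_biUnion.mpr ⟨h, hh, Finset.mem_filter.mpr ⟨hxS, hxh⟩⟩
  have hw' : (0 : ℝ) < w := by exact_mod_cast hw
  have h2 : (S₂.card : ℝ) ≤ 3 * X / w := by
    -- Two points of one block of length w would form a pair, so a block holds at most one point of
    -- `S₂`.
    have hinj : S₂.card ≤ (Finset.Icc (X / w) ((2 * X - 1) / w)).card := by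
      refine Finset.card_le_card_of_injOn (· / w) ?_ ?_
      · intro x hx
        have := hS (Finset.mem_filter.mp hx).1
        simp only [Finset.mem_Ico] at this
        simp only [Finset.coe_Icc, Set.mem_Icc]
        exact ⟨Nat.div_le_div_right this.1, Nat.div_le_div_right (by omega)⟩
      · have key : ∀ x ∈ S₂, ∀ y ∈ S₂, x < y → x / w = y / w → False := by
          intro x hx y hy hxy he
          refine (Finset.mem_filter.mp hx).2 ⟨y - x, ?_, ?_⟩
          · have h1 := Nat.div_add_mod x w
            have h2 := Nat.div_add_mod y w
            have h3 := Nat.mod_lt y hw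
            rw [← he] at h2
            simp only [Finset.mem_Ico]; omega
          · rw [Nat.add_sub_cancel' hxy.le]; exact (Finset.mem_filter.mp hy).1
        intro x hx y hy he
        rcases lt_trichotomy x y with h | h | h
        · exact (key x hx y hy h he).elim
        · exact h
        · exact (key y hy x hx h he.symm).elim
    have hX : 0 < X := by omega
    rw [Nat.card_Icc] at hinj
    have e1 : (((2 * X - 1) / w : ℕ) : ℝ) ≤ 2 * X / w := by
      refine Nat.cast_div_le.trans ?_
      gcongr
      exact_mod_cast (by omega : 2 * X - 1 ≤ 2 * X)
    have e2 : (X : ℝ) / w ≤ (X / w : ℕ) + 1 := by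
      rw [div_le_iff₀ hw']
      have := (Nat.lt_mul_div_succ X hw).le
      have h' : (X : ℝ) ≤ w * ((X / w : ℕ) + 1) := by exact_mod_cast this
      linarith
    have e3 : (1 : ℝ) ≤ X / w := by rw [one_le_div hw']; exact_mod_cast hwX
    have e4 : X / w ≤ (2 * X - 1) / w + 1 := by
      have := Nat.div_le_div_right (c := w) (by omega : X ≤ 2 * X - 1)
      omega
    have e5 : (((2 * X - 1) / w + 1 - X / w : ℕ) : ℝ) =
        (((2 * X - 1) / w : ℕ) : ℝ) + 1 - (X / w : ℕ) := by
      rw [Nat.cast_sub e4]; push_cast; ring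
    have e6 : (S₂.card : ℝ) ≤ (((2 * X - 1) / w + 1 - X / w : ℕ) : ℝ) := by exact_mod_cast hinj
    rw [e5] at e6
    have e7 : 3 * (X : ℝ) / w = 2 * X / w + X / w := by ring
    have e8 : 2 * (X : ℝ) / w = X / w + X / w := by ring
    linarith
  have h1' : (S₁.card : ℝ) ≤ ∑ h ∈ Finset.Ico 1 w, ((S.filter (· + h ∈ S)).card : ℝ) := by
    exact_mod_cast h1
  rw [hsplit]; push_cast
  linarith

/-- The value at `x` of the polynomial of degree at most `d` with natural coefficients `a`. -/
def natPolyEval (d : ℕ) (a : ℕ → ℕ) (x : ℕ) : ℕ := ∑ i ∈ Finset.range (d + 1), a i * x ^ i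

/-- Polynomials of exact degree `d` whose coefficients have the size of those of a polynomial
that is homogeneous of degree `d` in `x` and in parameters of size at most `X`. -/
def IsHomogeneousBounded (X c d : ℕ) (a : ℕ → ℕ) : Prop :=
  1 ≤ a d ∧ ∀ i ≤ d, a i ≤ c * X ^ (d - i)

/-- The coefficients of `(F (x + h) - F x) / h`. -/
def diffCoeff (d : ℕ) (a : ℕ → ℕ) (h i : ℕ) : ℕ :=
  ∑ l ∈ Finset.range (d + 2), if i < l then a l * (l.choose i * h ^ (l - i - 1)) else 0

lemma natPolyEval_add (d : ℕ) (a : ℕ → ℕ) (x h : ℕ) :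
    natPolyEval (d + 1) a (x + h) =
      natPolyEval (d + 1) a x + h * natPolyEval d (diffCoeff d a h) x := by
  have key : ∀ l ∈ Finset.range (d + 2), a l * (x + h) ^ l = a l * x ^ l +
      h * ∑ i ∈ Finset.range (d + 1),
        (if i < l then a l * (l.choose i * h ^ (l - i - 1)) else 0) * x ^ i := by
    intro l hl
    rw [Finset.mem_range] at hl
    have h1 : ∑ i ∈ Finset.range (d + 1),
        (if i < l then a l * (l.choose i * h ^ (l - i - 1)) else 0) * x ^ i =
        ∑ i ∈ Finset.range l, a l * (l.choose i * h ^ (l - i - 1)) * x ^ i := by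
      simp only [ite_mul, zero_mul]
      rw [← Finset.sum_filter]
      refine Finset.sum_congr ?_ fun _ _ ↦ rfl
      ext i; simp; omega
    rw [h1, add_pow, Finset.sum_range_succ, Nat.sub_self, Nat.choose_self, mul_add, Finset.mul_sum,
      Finset.mul_sum]
    simp only [pow_zero, mul_one, Nat.cast_one]
    rw [add_comm]
    congr 1
    refine Finset.sum_congr rfl fun i hi ↦ ?_
    rw [Finset.mem_range] at hi
    obtain ⟨m, rfl⟩ : ∃ m, l = i + m + 1 := ⟨l - i - 1, by omega⟩
    rw [show i + m + 1 - i = m + 1 by omega, show m + 1 - 1 = m by omega, pow_succ]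
    push_cast; ring
  unfold natPolyEval diffCoeff
  rw [Finset.sum_congr rfl key, Finset.sum_add_distrib, ← Finset.mul_sum, Finset.sum_comm]
  simp only [Finset.sum_mul]

/-- The shift h ≤ X acts as one more variable of size X, so the difference quotient is homogeneous
of degree one less; the constant pays for the number of terms and the binomial coefficients. -/
lemma IsHomogeneousBounded.differenced {X c d : ℕ} {a : ℕ → ℕ}
    (ha : IsHomogeneousBounded X c (d + 1) a) {h : ℕ} (hh : h ≤ X) :
    IsHomogeneousBounded X (c * ((d + 2) * 2 ^ (d + 1))) d (diffCoeff d a h) := by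
  constructor
  · refine le_trans ?_ (Finset.single_le_sum
      (f := fun l ↦ if d < l then a l * (l.choose d * h ^ (l - d - 1)) else 0)
      (fun _ _ ↦ Nat.zero_le _) (Finset.mem_range.mpr (by omega : d + 1 < d + 2)))
    simp only [Nat.lt_succ_self, if_true, Nat.choose_succ_self_right]
    have := ha.1
    rw [show d + 1 - d - 1 = 0 by omega, pow_zero, mul_one]
    exact Nat.mul_pos (by omega) (by omega)
  · intro i hi
    have hterm : ∀ l ∈ Finset.range (d + 2),
        (if i < l then a l * (l.choose i * h ^ (l - i - 1)) else 0) ≤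
          c * 2 ^ (d + 1) * X ^ (d - i) := by
      intro l hl
      rw [Finset.mem_range] at hl
      split_ifs with hil
      · calc a l * (l.choose i * h ^ (l - i - 1))
            ≤ c * X ^ (d + 1 - l) * (2 ^ (d + 1) * X ^ (l - i - 1)) := by
              refine Nat.mul_le_mul (ha.2 l (by omega))
                (Nat.mul_le_mul ?_ (Nat.pow_le_pow_left hh _))
              exact (Nat.choose_le_two_pow l i).trans (Nat.pow_le_pow_right (by norm_num) (by omega))
          _ = c * 2 ^ (d + 1) * (X ^ (d + 1 - l) * X ^ (l - i - 1)) := by ring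
          _ = c * 2 ^ (d + 1) * X ^ (d - i) := by
              rw [← pow_add]; congr 2; omega
      · exact Nat.zero_le _
    calc diffCoeff d a h i ≤ ∑ l ∈ Finset.range (d + 2), c * 2 ^ (d + 1) * X ^ (d - i) :=
          Finset.sum_le_sum hterm
      _ = _ := by simp; ring

lemma IsHomogeneousBounded.natPolyEval_le {X c d : ℕ} {a : ℕ → ℕ}
    (ha : IsHomogeneousBounded X c d a) {x : ℕ} (hx : x ≤ 2 * X) :
    natPolyEval d a x ≤ c * ((d + 1) * 2 ^ d) * X ^ d := by
  have hterm : ∀ i ∈ Finset.range (d + 1), a i * x ^ i ≤ c * 2 ^ d * X ^ d := by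
    intro i hi
    rw [Finset.mem_range] at hi
    calc a i * x ^ i ≤ c * X ^ (d - i) * (2 * X) ^ i :=
          Nat.mul_le_mul (ha.2 i (by omega)) (Nat.pow_le_pow_left hx i)
      _ = c * 2 ^ i * (X ^ (d - i) * X ^ i) := by rw [mul_pow]; ring
      _ = c * 2 ^ i * X ^ d := by rw [← pow_add]; congr 2; omega
      _ ≤ c * 2 ^ d * X ^ d := by gcongr; norm_num; omega
  calc natPolyEval d a x ≤ ∑ i ∈ Finset.range (d + 1), c * 2 ^ d * X ^ d :=
        Finset.sum_le_sum hterm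
    _ = _ := by simp; ring

/-- This makes evaluation injective, so that points x can be counted by the integers they produce.
-/
lemma natPolyEval_strictMono {d : ℕ} {a : ℕ → ℕ} (hd : 0 < d) (ha : 1 ≤ a d) :
    StrictMono (natPolyEval d a) := by
  intro x y hxy
  refine Finset.sum_lt_sum (fun i _ ↦ Nat.mul_le_mul_left _ (Nat.pow_le_pow_left hxy.le i))
    ⟨d, by simp, ?_⟩
  exact Nat.mul_lt_mul_of_pos_left (Nat.pow_lt_pow_left hxy hd.ne') ha

/-- Repeated differencing of the `x` in a dyadic interval at which `α u F(x)` is near an integer,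
with windows `w`, `w ^ 2`, `w ^ 4`, ... -/
lemma card_le_of_distInt_le {α : ℝ} {X k : ℕ} {M : ℕ} {D : ℝ}
    (hD : ∀ n ∈ Finset.Icc 1 M, (n.divisors.card : ℝ) ≤ D) (hD0 : 0 ≤ D) (hX : 0 < X) (j : ℕ) :
    ∀ (d c u w : ℕ) (a : ℕ → ℕ) (δ : ℝ) (S : Finset ℕ), j + 1 ≤ d → d ≤ k →
      IsHomogeneousBounded X c d a → 0 < u → 0 < w → (j = 0 ∨ w ^ 2 ^ (j - 1) ≤ X) →
      S ⊆ Finset.Ico X (2 * X) →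
      (∀ x ∈ S, distInt (α * ((u * natPolyEval d a x : ℕ) : ℝ)) ≤ δ) →
      u * (c * ((k + 1) * 2 ^ k) ^ (j + 1)) * w ^ (2 ^ j - 1) * X ^ (d - j) ≤ M →
      (S.card : ℝ) ≤ j * (3 * X / w) + D ^ j * (((Finset.Icc 1 M).filter
        fun n : ℕ ↦ u ∣ n ∧ distInt (α * n) ≤ 2 ^ j * δ).card : ℝ) := by
  induction j with
  | zero =>
    intro d c u w a δ S hd hdk ha hu hw _ hS hdist hM
    simp only [pow_zero, Nat.cast_zero, zero_mul, one_mul, zero_add, Nat.sub_self, mul_one,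
      pow_one, Nat.sub_zero] at hM ⊢
    have : S.card ≤ ((Finset.Icc 1 M).filter fun n : ℕ ↦ u ∣ n ∧ distInt (α * n) ≤ δ).card := by
      refine Finset.card_le_card_of_injOn (fun x ↦ u * natPolyEval d a x) ?_ ?_
      · intro x hx
        have hxX := hS hx
        simp only [Finset.mem_Ico] at hxX
        simp only [Finset.coe_filter, Finset.mem_Icc, Set.mem_ofPred_eq]
        refine ⟨⟨Nat.mul_pos hu ?_, le_trans ?_ hM⟩, Dvd.intro _ rfl, hdist x hx⟩
        · exact lt_of_le_of_lt (Nat.zero_le _)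
            (natPolyEval_strictMono (by omega) ha.1 (by omega : 0 < x))
        · calc u * natPolyEval d a x ≤ u * (c * ((d + 1) * 2 ^ d) * X ^ d) :=
                Nat.mul_le_mul_left u (ha.natPolyEval_le (by omega))
            _ ≤ u * (c * ((k + 1) * 2 ^ k) * X ^ d) := by gcongr; norm_num
            _ = _ := by ring
      · intro x _ y _ hxy
        exact (natPolyEval_strictMono (by omega) ha.1).injective (Nat.eq_of_mul_eq_mul_left hu hxy)
    exact_mod_cast this
  | succ j ih =>
    intro d c u w a δ S hd hdk ha hu hw hwX hS hdist hM
    obtain ⟨d, rfl⟩ : ∃ e, d = e + 1 := ⟨d - 1, by omega⟩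
    have hwX' : w ^ 2 ^ j ≤ X := by simpa using hwX
    have hwX1 : w ≤ X := le_trans (Nat.le_self_pow (by positivity) w) hwX'
    have hw' : (0 : ℝ) < w := by exact_mod_cast hw
    -- For a pair x, x + h the subtraction leads to the same problem with u h, w² and 2δ for u, w
    -- and δ. The window is squared because fewer than w shifts are summed: a loss X/w² for each
    -- adds up to X/w again.
    have hstep : ∀ h ∈ Finset.Ico 1 w, ((S.filter (· + h ∈ S)).card : ℝ) ≤
        j * (3 * X / (w ^ 2 : ℕ)) + D ^ j * (((Finset.Icc 1 M).filter
          fun n : ℕ ↦ u * h ∣ n ∧ distInt (α * n) ≤ 2 ^ j * (2 * δ)).card : ℝ) := by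
      intro h hh
      rw [Finset.mem_Ico] at hh
      refine ih d (c * ((k + 1) * 2 ^ k)) (u * h) (w ^ 2) (diffCoeff d a h) (2 * δ) _ (by omega)
        (by omega) ?_ (Nat.mul_pos hu (by omega)) (by positivity) ?_
        ((Finset.filter_subset _ _).trans hS) ?_ (le_trans ?_ hM)
      · have hb := ha.differenced (h := h) (by omega)
        refine ⟨hb.1, fun i hi ↦ (hb.2 i hi).trans ?_⟩
        have hpow : 2 ^ (d + 1) ≤ 2 ^ k := Nat.pow_le_pow_right (by norm_num) hdk
        exact Nat.mul_le_mul_right _ (Nat.mul_le_mul_left c (Nat.mul_le_mul (by omega) hpow))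
      · rcases Nat.eq_zero_or_pos j with hj | hj
        · exact Or.inl hj
        · right
          rw [← pow_mul, ← pow_succ', Nat.sub_add_cancel hj]
          exact hwX'
      · intro x hx
        rw [Finset.mem_filter] at hx
        have h1 := hdist _ hx.1
        have h2 := hdist _ hx.2
        rw [natPolyEval_add] at h2
        have h3 := distInt_sub_le (α * ((u * (natPolyEval (d + 1) a x +
          h * natPolyEval d (diffCoeff d a h) x) : ℕ) : ℝ))
          (α * ((u * natPolyEval (d + 1) a x : ℕ) : ℝ))
        have h4 : α * ((u * (natPolyEval (d + 1) a x +
            h * natPolyEval d (diffCoeff d a h) x) : ℕ) : ℝ) -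
            α * ((u * natPolyEval (d + 1) a x : ℕ) : ℝ) =
            α * ((u * h * natPolyEval d (diffCoeff d a h) x : ℕ) : ℝ) := by push_cast; ring
        rw [h4] at h3
        linarith
      · have hpow : w * (w ^ 2) ^ (2 ^ j - 1) = w ^ (2 ^ (j + 1) - 1) := by
          rw [← pow_mul, ← pow_succ']
          congr 1
          have : 1 ≤ 2 ^ j := Nat.one_le_two_pow
          rw [pow_succ]; omega
        calc u * h * (c * ((k + 1) * 2 ^ k) * ((k + 1) * 2 ^ k) ^ (j + 1)) *
              (w ^ 2) ^ (2 ^ j - 1) * X ^ (d - j)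
            ≤ u * w * (c * ((k + 1) * 2 ^ k) * ((k + 1) * 2 ^ k) ^ (j + 1)) *
              (w ^ 2) ^ (2 ^ j - 1) * X ^ (d - j) := by gcongr; omega
          _ = u * (c * ((k + 1) * 2 ^ k) ^ (j + 1 + 1)) * (w * (w ^ 2) ^ (2 ^ j - 1)) *
              X ^ (d - j) := by ring
          _ = _ := by rw [hpow]; congr 2; omega
    have hpairs := card_le_add_sum_pairs hw hwX1 hS
    set Q := (Finset.Icc 1 M).filter fun n : ℕ ↦ u ∣ n ∧ distInt (α * n) ≤ 2 ^ (j + 1) * δ with hQ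
    -- The condition u h ∣ n is all that is remembered of how n arose, and it is what lets the
    -- shifts be summed at the cost of one factor D.
    have hcards : ∑ h ∈ Finset.Ico 1 w, (((Finset.Icc 1 M).filter
        fun n : ℕ ↦ u * h ∣ n ∧ distInt (α * n) ≤ 2 ^ j * (2 * δ)).card : ℝ) ≤
        D * (Q.card : ℝ) := by
      have := sum_sum_dvd_le (F := fun n : ℕ ↦ if u ∣ n ∧ distInt (α * n) ≤ 2 ^ (j + 1) * δ then 1 else 0)
        (fun n ↦ by split_ifs <;> norm_num) hD (Finset.Ico 1 w)
      refine le_trans (Finset.sum_le_sum fun h _ ↦ ?_) (this.trans (le_of_eq ?_))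
      · rw [← Finset.sum_filter, Finset.sum_const, nsmul_eq_mul, mul_one]
        refine Nat.cast_le.mpr (Finset.card_le_card fun n hn ↦ ?_)
        simp only [Finset.mem_filter] at hn ⊢
        refine ⟨⟨hn.1, dvd_of_mul_left_dvd hn.2.1⟩, dvd_of_mul_right_dvd hn.2.1, ?_⟩
        rw [pow_succ, mul_assoc]; exact hn.2.2
      · rw [← Finset.sum_filter, Finset.sum_const, nsmul_eq_mul, mul_one]
    have hfirst : ∑ h ∈ Finset.Ico 1 w, (j * (3 * X / (w ^ 2 : ℕ)) : ℝ) ≤ j * (3 * X / w) := by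
      rw [Finset.sum_const, Nat.card_Ico, nsmul_eq_mul]
      calc ((w - 1 : ℕ) : ℝ) * (j * (3 * X / (w ^ 2 : ℕ)))
          ≤ w * (j * (3 * X / (w ^ 2 : ℕ))) := by gcongr; omega
        _ = j * (3 * X / w) := by push_cast; field_simp
    calc (S.card : ℝ) ≤ 3 * X / w + ∑ h ∈ Finset.Ico 1 w, ((S.filter (· + h ∈ S)).card : ℝ) := hpairs
      _ ≤ 3 * X / w + ∑ h ∈ Finset.Ico 1 w, (j * (3 * X / (w ^ 2 : ℕ)) +
            D ^ j * (((Finset.Icc 1 M).filter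
              fun n : ℕ ↦ u * h ∣ n ∧ distInt (α * n) ≤ 2 ^ j * (2 * δ)).card : ℝ)) := by
          gcongr with h hh
          exact hstep h hh
      _ ≤ 3 * X / w + (j * (3 * X / w) + D ^ j * (D * (Q.card : ℝ))) := by
          rw [Finset.sum_add_distrib, ← Finset.mul_sum (f := fun h ↦ (((Finset.Icc 1 M).filter
              fun n : ℕ ↦ u * h ∣ n ∧ distInt (α * n) ≤ 2 ^ j * (2 * δ)).card : ℝ))]
          gcongr
      _ = _ := by push_cast; ring

lemma natPolyEval_single (k x : ℕ) : natPolyEval k (fun i ↦ if i = k then 1 else 0) x = x ^ k := by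
  simp [natPolyEval]

lemma isHomogeneousBounded_single {X k : ℕ} :
    IsHomogeneousBounded X 1 k (fun i ↦ if i = k then 1 else 0) := by
  refine ⟨by simp, fun i hi ↦ ?_⟩
  dsimp only
  split_ifs with h
  · simp [h]
  · exact Nat.zero_le _

/-- The number of differencing steps to be used for a given length `X`. -/
lemma exists_differencing_depth {t X k : ℕ} (ht : 0 < t) (hk : 0 < k) :
    ∃ j < k, (j = 0 ∨ t ^ 2 ^ (j - 1) ≤ X) ∧ t ^ 2 ^ j * X ^ (k - 1 - j) ≤ t ^ 2 ^ (k - 1) := by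
  -- Either the windows t^(2^j) outgrow X at some step, where the differencing stops, or all of them
  -- fit and j = k - 1.
  have key : ∀ i, (∃ j ≤ i, (j = 0 ∨ t ^ 2 ^ (j - 1) ≤ X) ∧ X < t ^ 2 ^ j) ∨
      (i = 0 ∨ t ^ 2 ^ (i - 1) ≤ X) := by
    intro i
    induction i with
    | zero => exact Or.inr (Or.inl rfl)
    | succ i ih =>
      rcases ih with ⟨j, hj, h⟩ | h
      · exact Or.inl ⟨j, by omega, h⟩
      · rcases lt_or_ge X (t ^ 2 ^ i) with hlt | hge
        · exact Or.inl ⟨i, by omega, h, hlt⟩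
        · exact Or.inr (Or.inr hge)
  rcases key (k - 1) with ⟨j, hj, h1, h2⟩ | h
  · refine ⟨j, by omega, h1, ?_⟩
    have h3 : k - 1 - j + 1 ≤ 2 ^ (k - 1 - j) := Nat.lt_two_pow_self
    calc t ^ 2 ^ j * X ^ (k - 1 - j) ≤ t ^ 2 ^ j * (t ^ 2 ^ j) ^ (k - 1 - j) := by gcongr
      _ = t ^ (2 ^ j * (k - 1 - j + 1)) := by rw [← pow_mul, ← pow_add]; ring_nf
      _ ≤ t ^ (2 ^ j * 2 ^ (k - 1 - j)) := by gcongr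
      _ = t ^ 2 ^ (k - 1) := by rw [← pow_add]; congr 2; omega
  · exact ⟨k - 1, by omega, h, by simp⟩

/-! ### Counting pairs (r, x) with α r x^k near an integer -/

/-- The parameters of the argument: `α` is close to `a / q` with `√N < q ≤ N`, the variable `x`
runs over `[X, 2X)`, the variable `y` up to `Y ≍ N / X`, and `t` is at most `N ^ (2 ^ (-k))`. -/
structure WeylSetup (k N t X Y : ℕ) (α : ℝ) (a : ℤ) (q : ℕ) : Prop where
  two_le_k : 2 ≤ k
  t_pos : 0 < t
  t_pow_le : t ^ 2 ^ k ≤ N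
  lt_q_sq : N < q ^ 2
  q_le : q ≤ N
  coprime : IsCoprime a (q : ℤ)
  approx : |α - a / q| ≤ 1 / (q : ℝ) ^ 2
  X_pos : 0 < X
  X_le : X ≤ Y
  N_le : N ≤ 2 * (X * Y)
  XY_le : X * Y ≤ N

namespace WeylSetup

variable {k N t X Y q : ℕ} {α : ℝ} {a : ℤ}

lemma q_pos (h : WeylSetup k N t X Y α a q) : 0 < q := by
  rcases Nat.eq_zero_or_pos q with h0 | h0
  · have := h.lt_q_sq; simp [h0] at this
  · exact h0

lemma Y_pos (h : WeylSetup k N t X Y α a q) : 0 < Y := h.X_pos.trans_le h.X_le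

lemma t_pow_half_sq (h : WeylSetup k N t X Y α a q) : (t ^ 2 ^ (k - 1)) ^ 2 ≤ N := by
  have := h.two_le_k
  rw [← pow_mul, ← pow_succ, show k - 1 + 1 = k by omega]
  exact h.t_pow_le

lemma t_pow_half_le_q (h : WeylSetup k N t X Y α a q) : t ^ 2 ^ (k - 1) ≤ q :=
  (lt_of_pow_lt_pow_left₀ 2 (Nat.zero_le _) (h.t_pow_half_sq.trans_lt h.lt_q_sq)).le

lemma N_le_Y_sq (h : WeylSetup k N t X Y α a q) : N ≤ 2 * Y ^ 2 := by
  have := Nat.mul_le_mul_right Y h.X_le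
  have := h.N_le
  rw [pow_two]; omega

lemma t_sq_le (h : WeylSetup k N t X Y α a q) : t ^ 2 ≤ 2 * Y := by
  have hk := h.two_le_k
  refine (Nat.pow_le_pow_iff_left (two_ne_zero)).mp ?_
  calc (t ^ 2) ^ 2 = t ^ 2 ^ 2 := by rw [← pow_mul]; norm_num
    _ ≤ t ^ 2 ^ k := by
        gcongr
        · exact h.t_pos
        · norm_num
    _ ≤ N := h.t_pow_le
    _ ≤ 2 * Y ^ 2 := h.N_le_Y_sq
    _ ≤ (2 * Y) ^ 2 := by rw [mul_pow]; gcongr; norm_num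

lemma Y_sq_le (h : WeylSetup k N t X Y α a q) : Y ^ 2 ≤ Y ^ k :=
  Nat.pow_le_pow_right h.Y_pos h.two_le_k

lemma q_mul_t_sq_le (h : WeylSetup k N t X Y α a q) : q * t ^ 2 ≤ 4 * (X * Y ^ k) := by
  calc q * t ^ 2 ≤ (2 * (X * Y)) * (2 * Y) := Nat.mul_le_mul (h.q_le.trans h.N_le) h.t_sq_le
    _ = 4 * (X * Y ^ 2) := by ring
    _ ≤ _ := by gcongr 4 * (X * ?_); exact h.Y_sq_le

/-- A multiple of `α` that is near an integer forces the ranges not to be too short. -/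
lemma t_le_of_distInt_le (h : WeylSetup k N t X Y α a q) {r x R : ℕ} (hr : 0 < r) (hrR : r ≤ R)
    (hx : x ∈ Finset.Ico X (2 * X))
    (hd : distInt (α * ((r * x ^ k : ℕ) : ℝ)) ≤ t / (Y : ℝ) ^ k) :
    t ≤ 2 ^ (k + 1) * (R * X) := by
  have hk := h.two_le_k
  have hRX : 0 < R * X := Nat.mul_pos (by omega) h.X_pos
  rw [Finset.mem_Ico] at hx
  by_contra! hcon
  have ht1 : 2 ^ (k + 1) < t := lt_of_le_of_lt (Nat.le_mul_of_pos_right _ hRX) hcon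
  have hXt : X < t := by
    refine lt_of_le_of_lt ?_ hcon
    calc X ≤ R * X := Nat.le_mul_of_pos_left _ (by omega)
      _ ≤ _ := Nat.le_mul_of_pos_left _ (by positivity)
  -- If r x^k ≤ q/2, spacing gives ‖α r x^k‖ ≥ 1/(2q), so Y^k ≤ 2tN; this is incompatible with X <
  -- t, which makes Y at least N/(2t). Otherwise t^k ≤ q < 2 r x^k already bounds t in terms of R X.
  rcases le_or_gt (2 * (r * x ^ k)) q with hn | hn
  · have h1 := (inv_two_mul_le_distInt h.q_pos h.coprime h.approx
      (Nat.mul_pos hr (Nat.pow_pos (by have := h.X_pos; omega))) hn).trans hd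
    have hq' : (0 : ℝ) < q := by exact_mod_cast h.q_pos
    have hY' : (0 : ℝ) < Y := by exact_mod_cast h.Y_pos
    rw [div_le_div_iff₀ (by positivity) (by positivity), one_mul] at h1
    have h2 : Y ^ k ≤ t * (2 * q) := by exact_mod_cast h1
    have hN : 0 < N := h.q_pos.trans_le h.q_le
    have h3 : N ^ (k - 1) * N ≤ (2 ^ (k + 1) * t ^ (k + 1)) * N := by
      calc N ^ (k - 1) * N = N ^ k := by rw [← pow_succ]; congr 1; omega
        _ ≤ (2 * (t * Y)) ^ k := by
            refine Nat.pow_le_pow_left (h.N_le.trans ?_) k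
            gcongr
        _ = 2 ^ k * t ^ k * Y ^ k := by rw [mul_pow, mul_pow]; ring
        _ ≤ 2 ^ k * t ^ k * (t * (2 * N)) := by
            gcongr; exact h2.trans (by gcongr; exact h.q_le)
        _ = _ := by ring
    have h4 := Nat.le_of_mul_le_mul_right h3 hN
    have h5 : t ^ (k + 2) ≤ N ^ (k - 1) := by
      have h6 : k + 2 ≤ 2 ^ k := by
        obtain ⟨m, rfl⟩ : ∃ m, k = m + 2 := ⟨k - 2, by omega⟩
        have := Nat.lt_two_pow_self (n := m)
        rw [pow_add]; omega
      calc t ^ (k + 2) ≤ t ^ 2 ^ k := Nat.pow_le_pow_right h.t_pos h6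
        _ ≤ N := h.t_pow_le
        _ ≤ N ^ (k - 1) := Nat.le_self_pow (by omega) N
    have h6 : 2 ^ (k + 1) * t ^ (k + 1) < t ^ (k + 2) := by
      rw [pow_succ t (k + 1), mul_comm]
      exact Nat.mul_lt_mul_of_pos_left ht1 (Nat.pow_pos h.t_pos)
    omega
  · have h1 : t ^ k < (2 ^ (k + 1) * (R * X)) ^ k := by
      have hk1 : k ≤ 2 ^ (k - 1) := by
        have := Nat.lt_two_pow_self (n := k - 1); omega
      have hR : 0 < R := by omega
      calc t ^ k ≤ t ^ 2 ^ (k - 1) := Nat.pow_le_pow_right h.t_pos hk1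
        _ ≤ q := h.t_pow_half_le_q
        _ < 2 * (r * x ^ k) := hn
        _ ≤ 2 * (R * (2 * X) ^ k) := by gcongr; omega
        _ ≤ 2 ^ k * (R ^ k * (2 * X) ^ k) := by
            gcongr
            · exact Nat.le_self_pow (by omega) 2
            · exact Nat.le_self_pow (by omega) R
        _ = (4 * (R * X)) ^ k := by rw [← mul_pow, ← mul_pow]; ring_nf
        _ ≤ _ := by
            gcongr
            calc 4 = 2 ^ 2 := by norm_num
              _ ≤ 2 ^ (k + 1) := Nat.pow_le_pow_right (by norm_num) (by omega)
    exact absurd (lt_of_pow_lt_pow_left₀ k (Nat.zero_le _) h1) (by omega)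

/-- For few pairs `(r, x)` is `α r x ^ k` very close to an integer. -/
lemma sum_card_distInt_le (h : WeylSetup k N t X Y α a q) {D : ℝ} (hD1 : 1 ≤ D) {R : ℕ} (hR : 0 < R)
    (hD : ∀ n ∈ Finset.Icc 1 (((k + 1) * 2 ^ k) ^ k * (R * N ^ (k + 1))),
      (n.divisors.card : ℝ) ≤ D) :
    ∑ r ∈ Finset.Icc 1 R, (((Finset.Ico X (2 * X)).filter
      fun x : ℕ ↦ distInt (α * ((r * x ^ k : ℕ) : ℝ)) ≤ t / (Y : ℝ) ^ k).card : ℝ) ≤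
      (3 * k + 22 * 2 ^ k + 22 * 2 ^ k * ((k + 1) * 2 ^ k) ^ k) * D ^ k * (R * X / t) := by
  have hk := h.two_le_k
  set κ := (k + 1) * 2 ^ k with hκ
  have hκ1 : 1 ≤ κ := Nat.mul_pos (by omega) (by positivity)
  set δ : ℝ := t / (Y : ℝ) ^ k with hδ
  set S : ℕ → Finset ℕ := fun r ↦ (Finset.Ico X (2 * X)).filter
      fun x : ℕ ↦ distInt (α * ((r * x ^ k : ℕ) : ℝ)) ≤ δ with hS
  have ht' : (0 : ℝ) < t := by exact_mod_cast h.t_pos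
  have hq' : (0 : ℝ) < q := by exact_mod_cast h.q_pos
  have hY' : (0 : ℝ) < Y := by exact_mod_cast h.Y_pos
  have hN : 0 < N := h.q_pos.trans_le h.q_le
  -- The additive constant in the spacing count has to be absorbed into R X / t. This needs t ≪ R X,
  -- which the existence of a single pair provides.
  by_cases hemp : ∀ r ∈ Finset.Icc 1 R, S r = ∅
  · rw [Finset.sum_eq_zero fun r hr ↦ by
      show ((S r).card : ℝ) = 0
      rw [hemp r hr]; simp]
    positivity
  push Not at hemp
  obtain ⟨r₀, hr₀, x₀, hx₀⟩ := hemp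
  rw [Finset.mem_Icc] at hr₀
  rw [hS, Finset.mem_filter] at hx₀
  have htRX := h.t_le_of_distInt_le hr₀.1 hr₀.2 hx₀.1 hx₀.2
  obtain ⟨j, hjk, hjX, hjt⟩ := exists_differencing_depth (X := X) h.t_pos (by omega : 0 < k)
  set τ := t ^ 2 ^ (k - 1) with hτ
  set M := R * (1 * κ ^ (j + 1)) * t ^ (2 ^ j - 1) * X ^ (k - j) with hM
  have htτ : t ≤ τ := Nat.le_self_pow (by positivity) t
  have hMt : M * t ≤ κ ^ k * (R * X) * τ := by
    calc M * t = κ ^ (j + 1) * (R * X) * (t ^ 2 ^ j * X ^ (k - 1 - j)) := by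
          have e1 : t ^ 2 ^ j = t ^ (2 ^ j - 1) * t := by
            rw [← pow_succ]; congr 1
            have : 1 ≤ 2 ^ j := Nat.one_le_two_pow
            omega
          have e2 : X ^ (k - j) = X ^ (k - 1 - j) * X := by rw [← pow_succ]; congr 1; omega
          rw [hM, e1, e2]; ring
      _ ≤ κ ^ k * (R * X) * τ := by
          gcongr
          omega
  have hMle : M ≤ κ ^ k * (R * N ^ (k + 1)) := by
    have hτN : τ ≤ N := h.t_pow_half_le_q.trans h.q_le
    have hXN : X ≤ N := (Nat.le_mul_of_pos_right X h.Y_pos).trans h.XY_le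
    calc M ≤ M * t := Nat.le_mul_of_pos_right _ h.t_pos
      _ ≤ κ ^ k * (R * X) * τ := hMt
      _ ≤ κ ^ k * (R * N) * N := by gcongr
      _ = κ ^ k * (R * N ^ 2) := by ring
      _ ≤ _ := by gcongr; omega
  have hDM : ∀ n ∈ Finset.Icc 1 M, (n.divisors.card : ℝ) ≤ D := fun n hn ↦
    hD n (Finset.Icc_subset_Icc_right hMle hn)
  have hSr : ∀ r ∈ Finset.Icc 1 R, ((S r).card : ℝ) ≤ j * (3 * X / t) + D ^ j *
      (((Finset.Icc 1 M).filter fun n : ℕ ↦ r ∣ n ∧ distInt (α * n) ≤ 2 ^ j * δ).card : ℝ) := by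
    intro r hr
    rw [Finset.mem_Icc] at hr
    refine card_le_of_distInt_le hDM (by linarith) h.X_pos j k 1 r t _ δ (S r) hjk le_rfl
      isHomogeneousBounded_single hr.1 h.t_pos hjX (Finset.filter_subset _ _) ?_ ?_
    · intro x hx
      rw [natPolyEval_single]
      exact (Finset.mem_filter.mp hx).2
    · rw [hM]
      exact Nat.mul_le_mul_right _ (Nat.mul_le_mul_right _ (Nat.mul_le_mul_right _ hr.2))
  set Q := (Finset.Icc 1 M).filter fun n : ℕ ↦ distInt (α * n) ≤ 2 ^ j * δ with hQ
  have hsumQ : ∑ r ∈ Finset.Icc 1 R,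
      (((Finset.Icc 1 M).filter fun n : ℕ ↦ r ∣ n ∧ distInt (α * n) ≤ 2 ^ j * δ).card : ℝ) ≤
      D * (Q.card : ℝ) := by
    have := sum_sum_dvd_le (F := fun n : ℕ ↦ if distInt (α * n) ≤ 2 ^ j * δ then 1 else 0)
      (fun n ↦ by split_ifs <;> norm_num) hDM (Finset.Icc 1 R)
    refine le_trans (Finset.sum_le_sum fun r _ ↦ ?_) (this.trans (le_of_eq ?_))
    · rw [← Finset.sum_filter, Finset.sum_const, nsmul_eq_mul, mul_one, Finset.filter_filter]
    · rw [← Finset.sum_filter, Finset.sum_const, nsmul_eq_mul, mul_one]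
  have hQcard := card_distInt_le h.q_pos h.coprime h.approx (δ := 2 ^ j * δ) (by positivity) M
  -- The count (M/q + 1)(qδ + 1) expands into M/q, Mδ, qδ and 1; each is shown to be ≪ E.
  set E : ℝ := R * X / t with hE
  have hE0 : 0 ≤ E := by positivity
  have hMq : (M : ℝ) / q ≤ κ ^ k * E := by
    rw [hE, ← mul_div_assoc, div_le_div_iff₀ hq' ht']
    exact_mod_cast hMt.trans (Nat.mul_le_mul_left _ h.t_pow_half_le_q)
  have hMδ : M * δ ≤ 2 * κ ^ k * E := by
    rw [hδ, hE, ← mul_div_assoc, ← mul_div_assoc, div_le_div_iff₀ (by positivity) ht']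
    have : M * t * t ≤ 2 * κ ^ k * (R * X) * Y ^ k := by
      calc M * t * t ≤ κ ^ k * (R * X) * τ * τ := Nat.mul_le_mul hMt htτ
        _ = κ ^ k * (R * X) * τ ^ 2 := by ring
        _ ≤ κ ^ k * (R * X) * (2 * Y ^ k) := by
            gcongr
            exact h.t_pow_half_sq.trans (h.N_le_Y_sq.trans (by gcongr 2 * ?_; exact h.Y_sq_le))
        _ = _ := by ring
    exact_mod_cast this
  have hqδ : q * δ ≤ 4 * E := by
    rw [hδ, hE, ← mul_div_assoc, ← mul_div_assoc, div_le_div_iff₀ (by positivity) ht']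
    have : q * t * t ≤ 4 * (R * X) * Y ^ k := by
      calc q * t * t = q * t ^ 2 := by ring
        _ ≤ 4 * (X * Y ^ k) := h.q_mul_t_sq_le
        _ ≤ R * (4 * (X * Y ^ k)) := Nat.le_mul_of_pos_left _ hR
        _ = _ := by ring
    exact_mod_cast this
  have h1E : 1 ≤ 2 * 2 ^ k * E := by
    rw [hE, ← mul_div_assoc, one_le_div ht', ← pow_succ']
    exact_mod_cast htRX
  have h2j : (2 : ℝ) ^ j ≤ 2 ^ k := pow_le_pow_right₀ (by norm_num) hjk.le
  have hQle : (Q.card : ℝ) ≤ (22 * 2 ^ k + 22 * 2 ^ k * κ ^ k) * E := by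
    have hκE : (0 : ℝ) ≤ κ ^ k * E := by positivity
    have h2k : (1 : ℝ) ≤ 2 ^ k := one_le_pow₀ (by norm_num)
    have e1 : 2 ^ j * (M * δ) ≤ 2 ^ k * (2 * κ ^ k * E) := by gcongr
    have e2 : 2 ^ j * (q * δ) ≤ 2 ^ k * (4 * E) := by gcongr
    have e3 : (2 * M / q + 1) * (4 * q * (2 ^ j * δ) + 3) =
        8 * (2 ^ j * (M * δ)) + 6 * (M / q) + 4 * (2 ^ j * (q * δ)) + 3 := by
      field_simp; ring
    rw [e3] at hQcard
    nlinarith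
  have hD0 : 0 ≤ D := by linarith
  calc ∑ r ∈ Finset.Icc 1 R, ((S r).card : ℝ)
      ≤ ∑ r ∈ Finset.Icc 1 R, (j * (3 * X / t) + D ^ j * (((Finset.Icc 1 M).filter
          fun n : ℕ ↦ r ∣ n ∧ distInt (α * n) ≤ 2 ^ j * δ).card : ℝ)) := Finset.sum_le_sum hSr
    _ = R * (j * (3 * X / t)) + D ^ j * ∑ r ∈ Finset.Icc 1 R, (((Finset.Icc 1 M).filter
          fun n : ℕ ↦ r ∣ n ∧ distInt (α * n) ≤ 2 ^ j * δ).card : ℝ) := by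
        rw [Finset.sum_add_distrib, Finset.sum_const, Nat.card_Icc, Nat.add_sub_cancel,
          nsmul_eq_mul, ← Finset.mul_sum]
    _ ≤ R * (k * (3 * X / t)) + D ^ j * (D * ((22 * 2 ^ k + 22 * 2 ^ k * κ ^ k) * E)) := by
        gcongr
        exact hsumQ.trans (by gcongr)
    _ = 3 * k * E * 1 + D ^ (j + 1) * ((22 * 2 ^ k + 22 * 2 ^ k * κ ^ k) * E) := by
        rw [hE, pow_succ]; ring
    _ ≤ 3 * k * E * D ^ k + D ^ k * ((22 * 2 ^ k + 22 * 2 ^ k * κ ^ k) * E) := by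
        gcongr
        · exact one_le_pow₀ hD1
        · omega
    _ = _ := by rw [hκ]; push_cast; ring

end WeylSetup

/-! ### Averaging the Dirichlet denominators over x -/

/-- A dyadic majorant of `1 / r`. -/
lemma one_div_le_sum_dyadic {r t : ℕ} (hr : 0 < r) (ht : 0 < t) :
    (1 : ℝ) / r ≤ 1 / t + ∑ i ∈ Finset.range (Nat.log 2 t + 1),
      (1 / 2) ^ i * (if r ≤ 2 ^ (i + 1) then 1 else 0) := by
  have hnn : ∀ i ∈ Finset.range (Nat.log 2 t + 1),
      (0 : ℝ) ≤ (1 / 2) ^ i * (if r ≤ 2 ^ (i + 1) then 1 else 0) := fun i _ ↦ by positivity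
  rcases le_or_gt t r with h | h
  · have h1 : (1 : ℝ) / r ≤ 1 / t := by gcongr
    linarith [Finset.sum_nonneg hnn]
  · have hmem : Nat.log 2 r ∈ Finset.range (Nat.log 2 t + 1) := by
      rw [Finset.mem_range]
      exact Nat.lt_succ_of_le (Nat.log_mono_right h.le)
    have h1 := Finset.single_le_sum hnn hmem
    rw [if_pos (Nat.lt_pow_succ_log_self (by norm_num) r).le, mul_one, div_pow, one_pow] at h1
    have h2 : (1 : ℝ) / r ≤ 1 / 2 ^ Nat.log 2 r := by
      gcongr
      exact_mod_cast Nat.pow_log_le_self 2 hr.ne'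
    have : (0 : ℝ) ≤ 1 / t := by positivity
    linarith

/-- `D` bounds the divisor function on the range needed for `N`. -/
def DivisorBound (k N : ℕ) (D : ℝ) : Prop :=
  ∀ n ∈ Finset.Icc 1 (2 * ((k + 1) * 2 ^ k) ^ k * N ^ (k + 2)), (n.divisors.card : ℝ) ≤ D

/-- The power of 2 with exponent ⌊log₂ N⌋ has ⌊log₂ N⌋ + 1 divisors. Thus D absorbs all logarithms
as well. -/
lemma DivisorBound.log_le {k N : ℕ} {D : ℝ} (hD : DivisorBound k N D) (hN : 0 < N) :
    (Nat.log 2 N : ℝ) + 1 ≤ D := by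
  have h1 := hD (2 ^ Nat.log 2 N) (by
    rw [Finset.mem_Icc]
    refine ⟨Nat.one_le_two_pow, (Nat.pow_log_le_self 2 hN.ne').trans ?_⟩
    exact (Nat.le_self_pow (by omega) N).trans (Nat.le_mul_of_pos_left _ (by positivity)))
  rw [Nat.divisors_prime_pow Nat.prime_two] at h1
  simpa using h1

lemma DivisorBound.one_le {k N : ℕ} {D : ℝ} (hD : DivisorBound k N D) (hN : 0 < N) : 1 ≤ D := by
  have := hD.log_le hN
  have : (0 : ℝ) ≤ Nat.log 2 N := Nat.cast_nonneg _
  linarith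

namespace WeylSetup

variable {k N t X Y q : ℕ} {α : ℝ} {a : ℤ}

lemma N_pos (h : WeylSetup k N t X Y α a q) : 0 < N := h.q_pos.trans_le h.q_le

lemma t_le (h : WeylSetup k N t X Y α a q) : t ≤ 2 * Y :=
  (Nat.le_self_pow two_ne_zero t).trans h.t_sq_le

lemma Y_pow_pred_mul (h : WeylSetup k N t X Y α a q) : Y ^ (k - 1) * Y = Y ^ k := by
  have := h.two_le_k
  rw [← pow_succ]; congr 1; omega

lemma Y_pow_pred_le (h : WeylSetup k N t X Y α a q) : (Y : ℝ) ^ (k - 1) ≤ 2 * Y ^ k / t := by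
  have ht' : (0 : ℝ) < t := by exact_mod_cast h.t_pos
  rw [le_div_iff₀ ht']
  have : Y ^ (k - 1) * t ≤ 2 * Y ^ k := by
    calc Y ^ (k - 1) * t ≤ Y ^ (k - 1) * (2 * Y) := Nat.mul_le_mul_left _ h.t_le
      _ = 2 * (Y ^ (k - 1) * Y) := by ring
      _ = _ := by rw [h.Y_pow_pred_mul]
  exact_mod_cast this

lemma Y_le_N (h : WeylSetup k N t X Y α a q) : Y ≤ N :=
  (Nat.le_mul_of_pos_left Y h.X_pos).trans h.XY_le

/-- The sum over `m` for a single `x`, in terms of a rational approximation to `α x ^ k`. -/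
lemma exists_sum_recipMin_le (h : WeylSetup k N t X Y α a q) (x : ℕ) :
    ∃ r : ℕ, 0 < r ∧ distInt (α * ((r * x ^ k : ℕ) : ℝ)) ≤ t / (Y : ℝ) ^ k ∧
      ∑ m ∈ Finset.Icc 1 (k.factorial * Y ^ (k - 1)), recipMin Y (α * x ^ k * m) ≤
        84 * k.factorial * (Nat.log 2 Y + 1) * (Y : ℝ) ^ k * (1 / t + 1 / r) := by
  have ht' : (0 : ℝ) < t := by exact_mod_cast h.t_pos
  have hY' : (0 : ℝ) < Y := by exact_mod_cast h.Y_pos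
  have hk := h.two_le_k
  have htY : t ≤ Y ^ k := by
    have h1 := h.t_sq_le
    have h2 := h.Y_pos
    have h3 : t ≤ Y := by
      by_contra! hcon
      have : (Y + 1) * (Y + 1) ≤ t * t := Nat.mul_le_mul hcon hcon
      nlinarith
    exact h3.trans (Nat.le_self_pow (by omega) Y)
  -- With denominators up to Y^k/t, Dirichlet's theorem gives ‖α r x^k‖ ≤ t/Y^k and also keeps the
  -- term r of (2M/r + 1)(r + Y) below Y^k/t.
  set n₀ := Y ^ k / t with hn₀
  have hn₀pos : 0 < n₀ := Nat.div_pos htY h.t_pos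
  obtain ⟨p, hp1, hp2⟩ := Real.exists_rat_abs_sub_le_and_den_le (α * x ^ k) hn₀pos
  set r := p.den with hr
  have hr0 : 0 < r := p.den_pos
  have hr' : (0 : ℝ) < r := by exact_mod_cast hr0
  have hcast : (p : ℝ) = p.num / r := by rw [hr]; exact Rat.cast_def p
  rw [hcast] at hp1
  have hn1 : (Y : ℝ) ^ k / t ≤ n₀ + 1 := by
    rw [div_le_iff₀ ht']
    have := (Nat.lt_mul_div_succ (Y ^ k) h.t_pos).le
    have h' : (Y : ℝ) ^ k ≤ t * (n₀ + 1) := by exact_mod_cast this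
    linarith
  have hrle : (r : ℝ) ≤ Y ^ k / t := by
    have : (n₀ : ℝ) ≤ Y ^ k / t := by
      have := Nat.cast_div_le (α := ℝ) (m := Y ^ k) (n := t)
      exact_mod_cast this
    exact le_trans (by exact_mod_cast hp2) this
  refine ⟨r, hr0, ?_, ?_⟩
  · have h1 : α * ((r * x ^ k : ℕ) : ℝ) - p.num = (α * x ^ k - p.num / r) * r := by
      push_cast; field_simp
    calc distInt (α * ((r * x ^ k : ℕ) : ℝ)) ≤ |α * ((r * x ^ k : ℕ) : ℝ) - p.num| :=
          distInt_le_abs_sub _ _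
      _ = |α * x ^ k - p.num / r| * r := by rw [h1, abs_mul, abs_of_pos hr']
      _ ≤ 1 / ((n₀ + 1) * r) * r := by gcongr
      _ = 1 / (n₀ + 1) := by field_simp
      _ ≤ 1 / (Y ^ k / t) := by gcongr
      _ = _ := by rw [one_div_div]
  · have happ : |α * x ^ k - p.num / r| ≤ 1 / (r : ℝ) ^ 2 := by
      refine hp1.trans ?_
      rw [pow_two]
      gcongr
      have : (r : ℝ) ≤ n₀ := by exact_mod_cast hp2
      linarith
    have hcop : IsCoprime p.num (r : ℤ) := by
      rw [Int.isCoprime_iff_nat_coprime]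
      simpa using p.reduced
    refine (sum_recipMin_le hr0 hcop happ h.Y_pos _).trans ?_
    have hfac : (1 : ℝ) ≤ k.factorial := by exact_mod_cast Nat.one_le_iff_ne_zero.mpr k.factorial_ne_zero
    have e1 : (2 * ((k.factorial * Y ^ (k - 1) : ℕ) : ℝ) / r + 1) * (r + Y) =
        2 * k.factorial * Y ^ (k - 1) + 2 * k.factorial * (Y ^ (k - 1) * Y) / r + r + Y := by
      push_cast; field_simp; ring
    have e2 : (Y : ℝ) ^ (k - 1) * Y = Y ^ k := by exact_mod_cast h.Y_pow_pred_mul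
    have e3 := h.Y_pow_pred_le
    have e4 : (Y : ℝ) ≤ 2 * Y ^ k / t := by
      refine le_trans ?_ e3
      exact_mod_cast Nat.le_self_pow (by omega) Y
    have e5 : 2 * k.factorial * (Y : ℝ) ^ (k - 1) ≤ 2 * k.factorial * (2 * Y ^ k / t) := by gcongr
    have e6 : (r : ℝ) + Y ≤ k.factorial * (3 * (Y ^ k / t)) := by
      have : (0 : ℝ) ≤ 3 * (Y ^ k / t) := by positivity
      have e7 : 2 * (Y : ℝ) ^ k / t = 2 * (Y ^ k / t) := by ring
      rw [e7] at e4
      nlinarith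
    have e8 : (0 : ℝ) ≤ k.factorial * Y ^ k / r := by positivity
    have e9 : (2 * ((k.factorial * Y ^ (k - 1) : ℕ) : ℝ) / r + 1) * (r + Y) ≤
        7 * k.factorial * (Y : ℝ) ^ k * (1 / t + 1 / r) := by
      rw [e1, e2]
      have e10 : 7 * k.factorial * (Y : ℝ) ^ k * (1 / t + 1 / r) =
          2 * k.factorial * (2 * Y ^ k / t) + k.factorial * (3 * (Y ^ k / t)) +
            2 * k.factorial * Y ^ k / r + 5 * (k.factorial * Y ^ k / r) := by ring
      rw [e10]; linarith
    calc 12 * ((Nat.log 2 Y : ℝ) + 1) * (2 * ((k.factorial * Y ^ (k - 1) : ℕ) : ℝ) / r + 1) * (r + Y)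
        = 12 * ((Nat.log 2 Y : ℝ) + 1) *
          ((2 * ((k.factorial * Y ^ (k - 1) : ℕ) : ℝ) / r + 1) * (r + Y)) := by ring
      _ ≤ 12 * ((Nat.log 2 Y : ℝ) + 1) * (7 * k.factorial * (Y : ℝ) ^ k * (1 / t + 1 / r)) := by
          gcongr
      _ = _ := by ring

/-- The constant in the estimate of the double sum over `x` and `m`. -/
noncomputable def doubleSumConst (k : ℕ) : ℝ :=
  84 * k.factorial * (2 + 2 * (3 * k + 22 * 2 ^ k + 22 * 2 ^ k * ((k + 1) * 2 ^ k) ^ k))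

/-- In the dyadic majorant of 1/r_x the layer r_x ≤ 2^(i+1) has ≪ 2^(i+1) X/t points, up to powers
of D, by `sum_card_distInt_le`; its weight 2^(-i) cancels the growth. The remaining 1/t contributes
X/t in total. -/
lemma sum_sum_recipMin_le (h : WeylSetup k N t X Y α a q) {D : ℝ} (hD : DivisorBound k N D) :
    ∑ x ∈ Finset.Ico X (2 * X), ∑ m ∈ Finset.Icc 1 (k.factorial * Y ^ (k - 1)),
      recipMin Y (α * x ^ k * m) ≤ doubleSumConst k * D ^ (k + 2) * (Y : ℝ) ^ k * (X / t) := by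
  classical
  have hD1 := hD.one_le h.N_pos
  have hlogN := hD.log_le h.N_pos
  have htN : t ≤ N := (Nat.le_self_pow (by positivity) t).trans h.t_pow_le
  have hlogY : (Nat.log 2 Y : ℝ) + 1 ≤ D := by
    refine le_trans ?_ hlogN
    gcongr
    exact h.Y_le_N
  have hlogt : (Nat.log 2 t : ℝ) + 1 ≤ D := by
    refine le_trans ?_ hlogN
    gcongr
  choose r hr0 hrd hrB using h.exists_sum_recipMin_le
  set c : ℝ := 3 * k + 22 * 2 ^ k + 22 * 2 ^ k * ((k + 1) * 2 ^ k) ^ k with hc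
  set J := Finset.Ico X (2 * X) with hJ
  set δ : ℝ := t / (Y : ℝ) ^ k with hδ
  have hcount : ∀ i ∈ Finset.range (Nat.log 2 t + 1),
      ∑ x ∈ J, (1 / 2 : ℝ) ^ i * (if r x ≤ 2 ^ (i + 1) then 1 else 0) ≤
        2 * c * D ^ k * (X / t) := by
    intro i hi
    rw [Finset.mem_range] at hi
    -- The factor 2 in `DivisorBound` makes room for this R.
    have hR2 : 2 ^ (i + 1) ≤ 2 * N := by
      have : 2 ^ i ≤ t := (Nat.pow_le_pow_right (by norm_num) (by omega)).trans
        (Nat.pow_log_le_self 2 h.t_pos.ne')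
      rw [pow_succ]; omega
    have hmain := h.sum_card_distInt_le hD1 (R := 2 ^ (i + 1)) (by positivity) (fun n hn ↦ by
      refine hD n (Finset.Icc_subset_Icc_right ?_ hn)
      calc ((k + 1) * 2 ^ k) ^ k * (2 ^ (i + 1) * N ^ (k + 1))
          ≤ ((k + 1) * 2 ^ k) ^ k * (2 * N * N ^ (k + 1)) := by gcongr
        _ = _ := by ring)
    have hcard : ((J.filter fun x ↦ r x ≤ 2 ^ (i + 1)).card : ℝ) ≤
        ∑ s ∈ Finset.Icc 1 (2 ^ (i + 1)),
          ((J.filter fun x : ℕ ↦ distInt (α * ((s * x ^ k : ℕ) : ℝ)) ≤ δ).card : ℝ) := by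
      have : (J.filter fun x ↦ r x ≤ 2 ^ (i + 1)).card ≤ ∑ s ∈ Finset.Icc 1 (2 ^ (i + 1)),
          (J.filter fun x : ℕ ↦ distInt (α * ((s * x ^ k : ℕ) : ℝ)) ≤ δ).card := by
        refine (Finset.card_le_card (t := (Finset.Icc 1 (2 ^ (i + 1))).biUnion fun s ↦
          J.filter fun x : ℕ ↦ distInt (α * ((s * x ^ k : ℕ) : ℝ)) ≤ δ) fun x hx ↦ ?_).trans
          Finset.card_biUnion_le
        rw [Finset.mem_filter] at hx
        exact Finset.mem_biUnion.mpr ⟨r x, Finset.mem_Icc.mpr ⟨hr0 x, hx.2⟩,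
          Finset.mem_filter.mpr ⟨hx.1, hrd x⟩⟩
      exact_mod_cast this
    rw [← Finset.mul_sum, ← Finset.sum_filter, Finset.sum_const, nsmul_eq_mul, mul_one]
    calc (1 / 2 : ℝ) ^ i * ((J.filter fun x ↦ r x ≤ 2 ^ (i + 1)).card : ℝ)
        ≤ (1 / 2 : ℝ) ^ i * (c * D ^ k * ((2 ^ (i + 1) : ℕ) * X / t)) := by
          gcongr
          exact hcard.trans hmain
      _ = ((1 / 2 : ℝ) ^ i * 2 ^ i) * (2 * c * D ^ k * (X / t)) := by
          push_cast; rw [pow_succ]; ring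
      _ = _ := by rw [← mul_pow]; norm_num
  have hrsum : ∑ x ∈ J, (1 : ℝ) / r x ≤ X / t + D * (2 * c * D ^ k * (X / t)) := by
    calc ∑ x ∈ J, (1 : ℝ) / r x ≤ ∑ x ∈ J, (1 / t + ∑ i ∈ Finset.range (Nat.log 2 t + 1),
          (1 / 2 : ℝ) ^ i * (if r x ≤ 2 ^ (i + 1) then 1 else 0)) :=
          Finset.sum_le_sum fun x _ ↦ one_div_le_sum_dyadic (hr0 x) h.t_pos
      _ = X / t + ∑ i ∈ Finset.range (Nat.log 2 t + 1), ∑ x ∈ J,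
          (1 / 2 : ℝ) ^ i * (if r x ≤ 2 ^ (i + 1) then 1 else 0) := by
          rw [Finset.sum_add_distrib, Finset.sum_comm, Finset.sum_const, hJ, Nat.card_Ico,
            show 2 * X - X = X by omega, nsmul_eq_mul, mul_one_div]
      _ ≤ X / t + ∑ i ∈ Finset.range (Nat.log 2 t + 1), 2 * c * D ^ k * (X / t) := by
          gcongr with i hi
          exact hcount i hi
      _ = X / t + (Nat.log 2 t + 1) * (2 * c * D ^ k * (X / t)) := by
          rw [Finset.sum_const, Finset.card_range, nsmul_eq_mul]; push_cast; ring
      _ ≤ _ := by gcongr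
  calc _ ≤ ∑ x ∈ J, 84 * k.factorial * (Nat.log 2 Y + 1) * (Y : ℝ) ^ k * (1 / t + 1 / r x) :=
        Finset.sum_le_sum fun x _ ↦ hrB x
    _ = 84 * k.factorial * (Nat.log 2 Y + 1) * (Y : ℝ) ^ k *
          (X / t + ∑ x ∈ J, (1 : ℝ) / r x) := by
        rw [← Finset.mul_sum, Finset.sum_add_distrib, Finset.sum_const, hJ, Nat.card_Ico,
          show 2 * X - X = X by omega, nsmul_eq_mul, mul_one_div]
    _ ≤ 84 * k.factorial * D * (Y : ℝ) ^ k * (D ^ (k + 1) * (X / t) +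
          (D ^ (k + 1) * (X / t) + D * (2 * c * D ^ k * (X / t)))) := by
        have h1 : (X : ℝ) / t ≤ D ^ (k + 1) * (X / t) :=
          le_mul_of_one_le_left (by positivity) (one_le_pow₀ hD1)
        gcongr
        exact hrsum.trans (by gcongr)
    _ = _ := by rw [doubleSumConst, ← hc]; ring

end WeylSetup

/-! ### Mean value over a dyadic range of x -/

namespace WeylSetup

variable {k N t X Y q : ℕ} {α : ℝ} {a : ℤ}

/-- The constant in the estimate of the sum over a dyadic range of `x`. -/
noncomputable def dyadicConst (k : ℕ) : ℝ := 2 ^ 2 ^ (k - 1) * 2 ^ k * (2 * (k + doubleSumConst k))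

-- Hölder's inequality in x reduces this to the sum of |S_x|^K, where Weyl's inequality and the
-- averaged denominators apply. The diagonal term Y^(k-1) is harmless since t ≤ 2Y.
open Polynomial in
lemma sum_norm_pow_le (h : WeylSetup k N t X Y α a q) {D : ℝ} (hD : DivisorBound k N D)
    {f : ℝ[X]} (hf : f.natDegree = k) (hα : f.leadingCoeff = α) {A B : ℕ → ℤ}
    (hAB : ∀ x ∈ Finset.Ico X (2 * X), B x - A x ≤ Y) :
    (∑ x ∈ Finset.Ico X (2 * X), ‖∑ y ∈ Finset.Ico (A x) (B x),
      expTwoPiI (f.eval ((x : ℝ) * y))‖) ^ 2 ^ (k - 1) ≤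
      dyadicConst k * D ^ (2 * k + 1) * (N : ℝ) ^ 2 ^ (k - 1) * (1 / t) := by
  have hk := h.two_le_k
  have hD1 := hD.one_le h.N_pos
  have hY' : (0 : ℝ) < Y := by exact_mod_cast h.Y_pos
  have ht' : (0 : ℝ) < t := by exact_mod_cast h.t_pos
  set K := 2 ^ (k - 1) with hK
  have hkK : k ≤ K := by
    have := Nat.lt_two_pow_self (n := k - 1); omega
  set J := Finset.Ico X (2 * X) with hJ
  set S : ℕ → ℂ := fun x ↦ ∑ y ∈ Finset.Ico (A x) (B x), expTwoPiI (f.eval ((x : ℝ) * y)) with hS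
  set M := k.factorial * Y ^ (k - 1) with hM
  have hJcard : J.card = X := by rw [hJ, Nat.card_Ico]; omega
  have hDM : ∀ n ∈ Finset.Icc 1 M, (n.divisors.card : ℝ) ≤ D := by
    refine fun n hn ↦ hD n (Finset.Icc_subset_Icc_right ?_ hn)
    have h1 : k.factorial ≤ 2 * ((k + 1) * 2 ^ k) ^ k := by
      calc k.factorial ≤ k ^ k := Nat.factorial_le_pow k
        _ ≤ ((k + 1) * 2 ^ k) ^ k := by
            gcongr
            exact (Nat.le_succ k).trans (Nat.le_mul_of_pos_right _ (by positivity))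
        _ ≤ _ := Nat.le_mul_of_pos_left _ (by norm_num)
    refine Nat.mul_le_mul h1 ?_
    exact (Nat.pow_le_pow_left h.Y_le_N _).trans (Nat.pow_le_pow_right h.N_pos (by omega))
  have hpt : ∀ x ∈ J, ‖S x‖ ^ K ≤ (2 * Y : ℝ) ^ (K - k) * (k * 2 ^ k * (Y : ℝ) ^ (k - 1) +
      (2 * D) ^ (k - 1) * ∑ m ∈ Finset.Icc 1 M, recipMin Y (α * x ^ k * m)) := by
    intro x hx
    have hdeg : (f.comp (C (x : ℝ) * Polynomial.X)).natDegree ≤ (k - 1) + 1 := by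
      refine natDegree_comp_le.trans ?_
      rw [hf, show k - 1 + 1 = k by omega]
      calc k * (C (x : ℝ) * Polynomial.X).natDegree ≤ k * 1 :=
            Nat.mul_le_mul_left k ((natDegree_C_mul_le _ _).trans natDegree_X_le)
        _ = k := mul_one k
    have hcoeff : (f.comp (C (x : ℝ) * Polynomial.X)).coeff (k - 1 + 1) = α * x ^ k := by
      rw [show k - 1 + 1 = k by omega, comp_C_mul_X_coeff, ← hα, leadingCoeff, hf]
    have hW := norm_sum_pow_le_weylMajorant Y (k - 1) hdeg (hAB x hx)
    rw [hcoeff] at hW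
    simp only [eval_comp, eval_mul, eval_C, eval_X] at hW
    rw [show k - 1 + 1 = k by omega] at hW
    refine hW.trans ?_
    gcongr
    have hmaj := weylMajorant_le h.Y_pos hD1 (k - 1)
      (by rw [show k - 1 + 1 = k by omega]; exact hDM) (α * x ^ k)
    rw [show k - 1 + 1 = k by omega] at hmaj
    refine hmaj.trans ?_
    gcongr
    · omega
    · norm_num
    · omega
  obtain ⟨K', hK'⟩ : ∃ m, K = m + 1 := Nat.exists_eq_succ_of_ne_zero (by positivity)
  have hsumB := h.sum_sum_recipMin_le hD
  rw [← hM, ← hJ] at hsumB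
  set c := doubleSumConst k with hc
  have hc0 : 0 ≤ c := by rw [hc, doubleSumConst]; positivity
  have hsum : ∑ x ∈ J, ‖S x‖ ^ K ≤
      2 ^ K * 2 ^ k * (2 * (k + c)) * D ^ (2 * k + 1) * (Y : ℝ) ^ K * (X / t) := by
    have hDpow : (1 : ℝ) ≤ D ^ (2 * k + 1) := one_le_pow₀ hD1
    have e1 : (2 * Y : ℝ) ^ (K - k) * Y ^ k ≤ 2 ^ K * Y ^ K := by
      have : (Y : ℝ) ^ K = Y ^ (K - k) * Y ^ k := by rw [← pow_add]; congr 1; omega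
      rw [this, mul_pow, mul_assoc]
      gcongr
      · norm_num
      · omega
    have e2 : (2 * D) ^ (k - 1) * (c * D ^ (k + 2)) = 2 ^ (k - 1) * c * D ^ (2 * k + 1) := by
      have : D ^ (2 * k + 1) = D ^ (k - 1) * D ^ (k + 2) := by rw [← pow_add]; congr 1; omega
      rw [this, mul_pow]; ring
    have e3 : (2 : ℝ) ^ k = 2 ^ (k - 1) * 2 := by rw [← pow_succ]; congr 1; omega
    calc ∑ x ∈ J, ‖S x‖ ^ K ≤ ∑ x ∈ J, (2 * Y : ℝ) ^ (K - k) * (k * 2 ^ k * (Y : ℝ) ^ (k - 1) +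
          (2 * D) ^ (k - 1) * ∑ m ∈ Finset.Icc 1 M, recipMin Y (α * x ^ k * m)) :=
          Finset.sum_le_sum hpt
      _ = (2 * Y : ℝ) ^ (K - k) * (X * (k * 2 ^ k * (Y : ℝ) ^ (k - 1)) + (2 * D) ^ (k - 1) *
          ∑ x ∈ J, ∑ m ∈ Finset.Icc 1 M, recipMin Y (α * x ^ k * m)) := by
          rw [← Finset.mul_sum, Finset.sum_add_distrib, Finset.sum_const, hJcard, nsmul_eq_mul,
            ← Finset.mul_sum]
      _ ≤ (2 * Y : ℝ) ^ (K - k) * (X * (k * 2 ^ k * (2 * Y ^ k / t)) + (2 * D) ^ (k - 1) *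
          (c * D ^ (k + 2) * (Y : ℝ) ^ k * (X / t))) := by
          gcongr
          exact h.Y_pow_pred_le
      _ = (2 * Y : ℝ) ^ (K - k) * Y ^ k * (X / t) *
          (2 * k * 2 ^ k + (2 * D) ^ (k - 1) * (c * D ^ (k + 2))) := by ring
      _ = (2 * Y : ℝ) ^ (K - k) * Y ^ k * (X / t) *
          (2 * k * 2 ^ k * 1 + 2 ^ (k - 1) * c * D ^ (2 * k + 1)) := by rw [e2, mul_one]
      _ ≤ 2 ^ K * Y ^ K * (X / t) *
          (2 * k * 2 ^ k * D ^ (2 * k + 1) + 2 * 2 ^ k * c * D ^ (2 * k + 1)) := by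
          gcongr
          rw [e3]
          have : (0 : ℝ) < 2 ^ (k - 1) := by positivity
          linarith
      _ = _ := by ring
  have hXY : (X : ℝ) * Y ≤ N := by exact_mod_cast h.XY_le
  calc (∑ x ∈ J, ‖S x‖) ^ K ≤ (J.card : ℝ) ^ K' * ∑ x ∈ J, ‖S x‖ ^ K := by
        rw [hK']
        exact pow_sum_le_card_mul_sum_pow (fun _ _ ↦ norm_nonneg _) K'
    _ ≤ (X : ℝ) ^ K' * (2 ^ K * 2 ^ k * (2 * (k + c)) * D ^ (2 * k + 1) * (Y : ℝ) ^ K * (X / t)) := by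
        rw [hJcard]; gcongr
    _ = 2 ^ K * 2 ^ k * (2 * (k + c)) * D ^ (2 * k + 1) * (X * Y) ^ K * (1 / t) := by
        rw [mul_pow, hK', pow_succ (X : ℝ)]; ring
    _ ≤ 2 ^ K * 2 ^ k * (2 * (k + c)) * D ^ (2 * k + 1) * (N : ℝ) ^ K * (1 / t) := by gcongr
    _ = _ := by rw [dyadicConst]

end WeylSetup

/-! ### Hyperbola method and dyadic decomposition -/

/-- Dirichlet's hyperbola method. -/
lemma sum_card_divisors_mul (g : ℕ → ℂ) (N : ℕ) :
    ∑ n ∈ Finset.Icc 1 N, (n.divisors.card : ℂ) * g n =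
      2 * ∑ x ∈ Finset.Icc 1 N.sqrt, ∑ y ∈ Finset.Ioc x (N / x), g (x * y) +
        ∑ x ∈ Finset.Icc 1 N.sqrt, g (x * x) := by
  -- Lattice points under the hyperbola, split by x < y, x > y and x = y. The first two parts are
  -- exchanged by symmetry, and x < y forces x ≤ √N.
  set P := (Finset.Icc 1 N ×ˢ Finset.Icc 1 N).filter fun p ↦ p.1 * p.2 ≤ N with hP
  have hmem : ∀ p : ℕ × ℕ, p ∈ P ↔ 1 ≤ p.1 ∧ 1 ≤ p.2 ∧ p.1 * p.2 ≤ N := by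
    intro p
    simp only [hP, Finset.mem_filter, Finset.mem_product, Finset.mem_Icc]
    constructor
    · rintro ⟨⟨⟨h1, _⟩, h2, _⟩, h3⟩; exact ⟨h1, h2, h3⟩
    · rintro ⟨h1, h2, h3⟩
      exact ⟨⟨⟨h1, (Nat.le_mul_of_pos_right _ h2).trans h3⟩, h2,
        (Nat.le_mul_of_pos_left _ h1).trans h3⟩, h3⟩
  have h1 : ∑ n ∈ Finset.Icc 1 N, (n.divisors.card : ℂ) * g n = ∑ p ∈ P, g (p.1 * p.2) := by
    rw [← Finset.sum_fiberwise_of_maps_to (s := P) (t := Finset.Icc 1 N) (g := fun p ↦ p.1 * p.2)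
      (fun p hp ↦ by
        have := (hmem p).mp hp
        exact Finset.mem_Icc.mpr ⟨Nat.mul_pos this.1 this.2.1, this.2.2⟩)]
    refine Finset.sum_congr rfl fun n hn ↦ ?_
    rw [Finset.mem_Icc] at hn
    rw [Finset.sum_congr rfl (g := fun _ ↦ g n) fun p hp ↦ by rw [(Finset.mem_filter.mp hp).2],
      Finset.sum_const, nsmul_eq_mul]
    congr 2
    refine Finset.card_nbij' (fun d ↦ (d, n / d)) Prod.fst ?_ ?_ ?_ ?_
    · intro d hd
      have hd' := Nat.mem_divisors.mp hd
      have hmul := Nat.mul_div_cancel' hd'.1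
      simp only [Finset.coe_filter, Set.mem_ofPred_eq, hmem]
      refine ⟨⟨Nat.pos_of_mem_divisors hd, Nat.div_pos (Nat.le_of_dvd (by omega) hd'.1)
        (Nat.pos_of_mem_divisors hd), by omega⟩, hmul⟩
    · intro p hp
      have := (Finset.mem_filter.mp hp).2
      exact Nat.mem_divisors.mpr ⟨⟨p.2, this.symm⟩, by omega⟩
    · intro d _; rfl
    · intro p hp
      have hp' := Finset.mem_filter.mp hp
      have h1 := ((hmem p).mp hp'.1).1
      ext
      · rfl
      · simp only
        rw [← hp'.2, Nat.mul_div_cancel_left _ h1]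
  have hlt : ∑ p ∈ P.filter (fun p ↦ p.1 < p.2), g (p.1 * p.2) =
      ∑ x ∈ Finset.Icc 1 N.sqrt, ∑ y ∈ Finset.Ioc x (N / x), g (x * y) := by
    rw [Finset.sum_sigma']
    refine Finset.sum_nbij' (fun p ↦ ⟨p.1, p.2⟩) (fun s ↦ (s.1, s.2)) ?_ ?_ ?_ ?_ ?_
    · intro p hp
      rw [Finset.mem_filter, hmem] at hp
      simp only [Finset.mem_sigma, Finset.mem_Icc, Finset.mem_Ioc]
      refine ⟨⟨hp.1.1, Nat.le_sqrt.mpr ?_⟩, hp.2, (Nat.le_div_iff_mul_le hp.1.1).mpr ?_⟩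
      · exact (Nat.mul_le_mul_left _ hp.2.le).trans hp.1.2.2
      · rw [mul_comm]; exact hp.1.2.2
    · intro s hs
      simp only [Finset.mem_sigma, Finset.mem_Icc, Finset.mem_Ioc] at hs
      rw [Finset.mem_filter, hmem]
      have := (Nat.le_div_iff_mul_le (by omega : 0 < s.1)).mp hs.2.2
      exact ⟨⟨hs.1.1, by simp only; omega, by rw [mul_comm] at this; exact this⟩, hs.2.1⟩
    · intro p _; rfl
    · intro s _; rfl
    · intro p _; rfl
  have hgt : ∑ p ∈ P.filter (fun p ↦ p.2 < p.1), g (p.1 * p.2) =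
      ∑ p ∈ P.filter (fun p ↦ p.1 < p.2), g (p.1 * p.2) := by
    refine Finset.sum_nbij' Prod.swap Prod.swap ?_ ?_ ?_ ?_ ?_
    · intro p hp
      rw [Finset.mem_filter, hmem] at hp ⊢
      exact ⟨⟨hp.1.2.1, hp.1.1, by rw [mul_comm]; exact hp.1.2.2⟩, hp.2⟩
    · intro p hp
      rw [Finset.mem_filter, hmem] at hp ⊢
      exact ⟨⟨hp.1.2.1, hp.1.1, by rw [mul_comm]; exact hp.1.2.2⟩, hp.2⟩
    · intro p _; rfl
    · intro p _; rfl
    · intro p _; rw [Prod.fst_swap, Prod.snd_swap, mul_comm]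
  have heq : ∑ p ∈ P.filter (fun p ↦ p.1 = p.2), g (p.1 * p.2) =
      ∑ x ∈ Finset.Icc 1 N.sqrt, g (x * x) := by
    refine Finset.sum_nbij' Prod.fst (fun x ↦ (x, x)) ?_ ?_ ?_ ?_ ?_
    · intro p hp
      rw [Finset.mem_filter, hmem] at hp
      rw [Finset.mem_Icc]
      refine ⟨hp.1.1, Nat.le_sqrt.mpr ?_⟩
      have := hp.1.2.2
      rwa [← hp.2] at this
    · intro x hx
      rw [Finset.mem_Icc] at hx
      rw [Finset.mem_filter, hmem]
      exact ⟨⟨hx.1, hx.1, Nat.le_sqrt.mp hx.2⟩, rfl⟩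
    · intro p hp
      have := (Finset.mem_filter.mp hp).2
      ext
      · rfl
      · exact this
    · intro x _; rfl
    · intro p hp
      rw [← (Finset.mem_filter.mp hp).2]
  rw [h1, ← Finset.sum_filter_add_sum_filter_not P (fun p ↦ p.1 < p.2),
    ← Finset.sum_filter_add_sum_filter_not (P.filter fun p ↦ ¬ p.1 < p.2) (fun p ↦ p.1 = p.2)]
  have e1 : (P.filter fun p ↦ ¬ p.1 < p.2).filter (fun p ↦ p.1 = p.2) =
      P.filter fun p ↦ p.1 = p.2 := by
    rw [Finset.filter_filter]
    refine Finset.filter_congr fun p _ ↦ ?_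
    omega
  have e2 : (P.filter fun p ↦ ¬ p.1 < p.2).filter (fun p ↦ ¬ p.1 = p.2) =
      P.filter fun p ↦ p.2 < p.1 := by
    rw [Finset.filter_filter]
    refine Finset.filter_congr fun p _ ↦ ?_
    omega
  rw [e1, e2, hgt, hlt, heq]
  ring

lemma sum_Ioc_eq_sum_Ico_int (F : ℝ → ℂ) (a b : ℕ) :
    ∑ y ∈ Finset.Ioc a b, F (y : ℝ) = ∑ y ∈ Finset.Ico ((a : ℤ) + 1) (b + 1), F (y : ℝ) := by
  refine Finset.sum_nbij' (fun y ↦ (y : ℤ)) Int.toNat ?_ ?_ ?_ ?_ ?_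
  · intro y hy; simp at hy ⊢; omega
  · intro y hy; simp at hy ⊢; omega
  · intro y _; simp
  · intro y hy; simp at hy ⊢; omega
  · intro y _; simp

lemma sum_Icc_le_sum_dyadic {T : ℕ → ℝ} (hT : ∀ x, 0 ≤ T x) (s : ℕ) :
    ∑ x ∈ Finset.Icc 1 s, T x ≤
      ∑ i ∈ Finset.range (Nat.log 2 s + 1), ∑ x ∈ Finset.Ico (2 ^ i) (2 * 2 ^ i), T x := by
  rw [← Finset.sum_fiberwise_of_maps_to (s := Finset.Icc 1 s)
    (t := Finset.range (Nat.log 2 s + 1)) (g := fun x ↦ Nat.log 2 x)]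
  · refine Finset.sum_le_sum fun i _ ↦ Finset.sum_le_sum_of_subset_of_nonneg ?_ fun x _ _ ↦ hT x
    intro x hx
    rw [Finset.mem_filter, Finset.mem_Icc] at hx
    rw [Finset.mem_Ico, ← hx.2]
    have := Nat.lt_pow_succ_log_self (b := 2) (by norm_num) x
    rw [pow_succ] at this
    exact ⟨Nat.pow_log_le_self 2 (by omega), by omega⟩
  · intro x hx
    rw [Finset.mem_Icc] at hx
    rw [Finset.mem_range]
    exact Nat.lt_succ_of_le (Nat.log_mono_right hx.2)

/-! ### Choice of the parameters q, D and t -/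

/-- A point of the minor arcs has a rational approximation whose denominator is neither small
nor large. -/
lemma exists_approx_of_mem_minorArcs {α : ℝ} {N : ℕ} (hN : 0 < N)
    (hα : α ∈ minorArcs (N : ℝ) ((N : ℝ) ^ (1 / 2 : ℝ))) :
    ∃ (a : ℤ) (q : ℕ), N < q ^ 2 ∧ q ≤ N ∧ IsCoprime a (q : ℤ) ∧
      |α - a / q| ≤ 1 / (q : ℝ) ^ 2 := by
  obtain ⟨p, hp1, hp2⟩ := Real.exists_rat_abs_sub_le_and_den_le α hN
  have hN' : (0 : ℝ) < N := by exact_mod_cast hN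
  have hq' : (0 : ℝ) < p.den := by exact_mod_cast p.den_pos
  rw [Rat.cast_def] at hp1
  have hcop : IsCoprime p.num (p.den : ℤ) := by
    rw [Int.isCoprime_iff_nat_coprime]
    simpa using p.reduced
  have hqN : (p.den : ℝ) ≤ N := by exact_mod_cast hp2
  refine ⟨p.num, p.den, ?_, hp2, hcop, hp1.trans ?_⟩
  -- Dirichlet's theorem gives an error of at most 1/((N+1)q), so q² ≤ N would place α in the major
  -- arcs.
  · by_contra! hcon
    refine hα.2 ⟨p.num, p.den, p.den_pos, ?_, hcop, hp1.trans ?_⟩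
    · rw [← Real.sqrt_eq_rpow]
      exact Real.le_sqrt_of_sq_le (by exact_mod_cast hcon)
    · rw [mul_comm]
      gcongr
      linarith
  · rw [pow_two]
    gcongr
    linarith

lemma le_mul_rpow_inv_of_pow_le {s A v : ℝ} {K : ℕ} (hK : K ≠ 0) (hA : 0 ≤ A)
    (hv : 0 ≤ v) (h : s ^ K ≤ A ^ K * v) : s ≤ A * v ^ (K : ℝ)⁻¹ := by
  refine le_of_pow_le_pow_left₀ hK (by positivity) ?_
  rw [mul_pow, Real.rpow_inv_natCast_pow hv hK]
  exact h

/-- The divisor function on the relevant range is bounded by a small power of `N`. -/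
lemma exists_divisorBound (k : ℕ) {ε : ℝ} (hε : 0 < ε) :
    ∃ C : ℝ, 1 ≤ C ∧ ∀ N : ℕ, 0 < N → DivisorBound k N (C * (N : ℝ) ^ ε) := by
  set B := 2 * ((k + 1) * 2 ^ k) ^ k with hB
  set η : ℝ := ε / (k + 2) with hη
  have hη0 : 0 < η := by positivity
  obtain ⟨C, hC1, hC⟩ := exists_card_divisors_le_rpow hη0
  have hB1 : (1 : ℝ) ≤ B := by
    have : 1 ≤ B := Nat.mul_pos (by norm_num) (by positivity)
    exact_mod_cast this
  refine ⟨C * (B : ℝ) ^ η, one_le_mul_of_one_le_of_one_le hC1 (Real.one_le_rpow hB1 hη0.le),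
    fun N _ n hn ↦ ?_⟩
  rw [Finset.mem_Icc] at hn
  have hn' : (n : ℝ) ≤ B * (N : ℝ) ^ (k + 2) := by exact_mod_cast hn.2
  calc (n.divisors.card : ℝ) ≤ C * (n : ℝ) ^ η := hC n (by omega)
    _ ≤ C * (B * (N : ℝ) ^ (k + 2)) ^ η := by gcongr
    _ = C * (B : ℝ) ^ η * (N : ℝ) ^ ε := by
        rw [Real.mul_rpow (by positivity) (by positivity), ← Real.rpow_natCast, ← Real.rpow_mul
          (by positivity)]
        have : ((k + 2 : ℕ) : ℝ) * η = ε := by rw [hη]; push_cast; field_simp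
        rw [this]; ring

/-- t is the integer part of N^(2^-k); the factor 2 pays for rounding. -/
lemma exists_pow_le_and_le (k N : ℕ) (hN : 0 < N) :
    ∃ t : ℕ, 0 < t ∧ t ^ 2 ^ k ≤ N ∧ (1 : ℝ) / t ≤ 2 * (N : ℝ) ^ (-((2 : ℝ) ^ k)⁻¹) := by
  have hN' : (1 : ℝ) ≤ N := by exact_mod_cast hN
  set T : ℝ := (N : ℝ) ^ ((2 : ℝ) ^ k)⁻¹ with hT
  have hT1 : 1 ≤ T := Real.one_le_rpow hN' (by positivity)
  refine ⟨⌊T⌋₊, Nat.floor_pos.mpr hT1, ?_, ?_⟩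
  · have h1 : (⌊T⌋₊ : ℝ) ≤ T := Nat.floor_le (by linarith)
    have h2 : T ^ 2 ^ k = N := by
      have := Real.rpow_inv_natCast_pow (x := (N : ℝ)) (n := 2 ^ k) (by positivity) (by positivity)
      push_cast at this
      exact this
    have h3 : (⌊T⌋₊ : ℝ) ^ 2 ^ k ≤ N := by rw [← h2]; gcongr
    exact_mod_cast h3
  · have h1 : T < ⌊T⌋₊ + 1 := Nat.lt_floor_add_one T
    have h2 : (1 : ℝ) ≤ ⌊T⌋₊ := by exact_mod_cast Nat.floor_pos.mpr hT1
    rw [Real.rpow_neg (by positivity), ← hT, ← div_eq_mul_inv, div_le_div_iff₀ (by positivity)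
      (by positivity)]
    linarith

/-- The saving 1/t, with t ≍ N^(2^-k), undergoes a root of order 2^(k-1). -/
lemma weylGamma_half {k : ℕ} (hk : 2 ≤ k) :
    ((2 : ℝ) ^ k)⁻¹ * ((2 ^ (k - 1) : ℕ) : ℝ)⁻¹ = weylGamma k / 2 := by
  have h4 : weylGamma k = 4 / 4 ^ k := by
    rw [weylGamma, Real.rpow_sub (by norm_num), Real.rpow_one, Real.rpow_natCast]
  have h2 : (2 : ℝ) ^ k = 2 ^ (k - 1) * 2 := by rw [← pow_succ]; congr 1; omega
  have h3 : (4 : ℝ) ^ k = 2 ^ k * 2 ^ k := by rw [← mul_pow]; norm_num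
  rw [h4, h3, h2]
  push_cast
  field_simp
  norm_num

/-! ### Assembly -/

/-- The contribution of a dyadic range of `x`. -/
lemma sum_dyadic_le {k N t q : ℕ} {α : ℝ} {a : ℤ} (hk : 2 ≤ k) (ht : 0 < t) (htN : t ^ 2 ^ k ≤ N)
    (ht' : (1 : ℝ) / t ≤ 2 * (N : ℝ) ^ (-((2 : ℝ) ^ k)⁻¹)) (hqN : N < q ^ 2) (hq : q ≤ N)
    (hcop : IsCoprime a (q : ℤ)) (happ : |α - a / q| ≤ 1 / (q : ℝ) ^ 2) {D : ℝ}
    (hD : DivisorBound k N D) {f : Polynomial ℝ} (hf : f.natDegree = k) (hα : f.leadingCoeff = α)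
    {X : ℕ} (hX : 0 < X) (hXN : X ≤ N.sqrt) :
    ∑ x ∈ Finset.Ico X (2 * X),
      ‖∑ y ∈ Finset.Ioc x (N / x), expTwoPiI (f.eval ((x * y : ℕ) : ℝ))‖ ≤
        2 * (WeylSetup.dyadicConst k + 1) * D ^ (2 * k + 1) * (N : ℝ) ^ (1 - weylGamma k / 2) := by
  have hXX : X * X ≤ N := Nat.le_sqrt.mp hXN
  have h : WeylSetup k N t X (N / X) α a q :=
    { two_le_k := hk, t_pos := ht, t_pow_le := htN, lt_q_sq := hqN, q_le := hq, coprime := hcop,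
      approx := happ, X_pos := hX, X_le := (Nat.le_div_iff_mul_le hX).mpr hXX,
      N_le := by
        have h1 := Nat.lt_mul_div_succ N hX
        have h2 : X ≤ X * (N / X) := Nat.le_mul_of_pos_right _
          (Nat.div_pos ((Nat.le_mul_of_pos_right X hX).trans hXX) hX)
        rw [mul_add, mul_one] at h1
        omega
      XY_le := Nat.mul_div_le N X }
  have hN := h.N_pos
  have hN' : (0 : ℝ) < N := by exact_mod_cast hN
  have hD1 := hD.one_le hN
  set c := WeylSetup.dyadicConst k with hc
  have hc0 : 0 ≤ c := by
    rw [hc, WeylSetup.dyadicConst, WeylSetup.doubleSumConst]; positivity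
  set K := 2 ^ (k - 1) with hK
  have hK0 : K ≠ 0 := by positivity
  have hmain := h.sum_norm_pow_le hD hf hα (A := fun x ↦ (x : ℤ) + 1)
    (B := fun x ↦ ((N / x : ℕ) : ℤ) + 1) (fun x hx ↦ by
      rw [Finset.mem_Ico] at hx
      have : N / x ≤ N / X := Nat.div_le_div_left hx.1 hX
      omega)
  have hconv : ∀ x : ℕ, ∑ y ∈ Finset.Ioc x (N / x), expTwoPiI (f.eval ((x * y : ℕ) : ℝ)) =
      ∑ y ∈ Finset.Ico ((x : ℤ) + 1) (((N / x : ℕ) : ℤ) + 1),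
        expTwoPiI (f.eval ((x : ℝ) * y)) := by
    intro x
    rw [← sum_Ioc_eq_sum_Ico_int (fun y ↦ expTwoPiI (f.eval ((x : ℝ) * y)))]
    push_cast; rfl
  simp only [hconv]
  set E := (c + 1) * D ^ (2 * k + 1) with hE
  have hE1 : 1 ≤ E := one_le_mul_of_one_le_of_one_le (by linarith) (one_le_pow₀ hD1)
  -- As E ≥ 1, the constant may be enlarged to E^K, which makes it part of a perfect K-th power.
  have hpow := hmain.trans (b := _) (c := (E * N) ^ K * (1 / t)) (by
    rw [mul_pow]
    gcongr
    calc c * D ^ (2 * k + 1) ≤ E := by rw [hE]; gcongr; linarith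
      _ ≤ E ^ K := le_self_pow₀ hE1 hK0)
  refine (le_mul_rpow_inv_of_pow_le hK0 (by positivity) (by positivity) hpow).trans ?_
  have hKinv : (K : ℝ)⁻¹ ≤ 1 := by
    have : (1 : ℝ) ≤ K := by exact_mod_cast Nat.one_le_iff_ne_zero.mpr hK0
    exact inv_le_one_of_one_le₀ this
  calc E * N * (1 / t : ℝ) ^ (K : ℝ)⁻¹
      ≤ E * N * (2 * (N : ℝ) ^ (-((2 : ℝ) ^ k)⁻¹)) ^ (K : ℝ)⁻¹ := by gcongr
    _ = E * N * (2 ^ (K : ℝ)⁻¹ * (N : ℝ) ^ (-(weylGamma k / 2))) := by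
        rw [Real.mul_rpow (by norm_num) (by positivity), ← Real.rpow_mul hN'.le, neg_mul, hK,
          weylGamma_half hk]
    _ ≤ E * N * (2 * (N : ℝ) ^ (-(weylGamma k / 2))) := by
        gcongr
        calc (2 : ℝ) ^ (K : ℝ)⁻¹ ≤ 2 ^ (1 : ℝ) := by gcongr; norm_num
          _ = 2 := Real.rpow_one 2
    _ = 2 * (c + 1) * D ^ (2 * k + 1) * ((N : ℝ) ^ (1 : ℝ) * (N : ℝ) ^ (-(weylGamma k / 2))) := by
        rw [hE, Real.rpow_one]; ring
    _ = _ := by rw [← Real.rpow_add hN', sub_eq_add_neg]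

theorem mainTheorem5 (k : ℕ) (hk : 2 ≤ k) (ε : ℝ) (hε : 0 < ε) :
    ∃ C : ℝ, 0 < C ∧ ∀ N : ℕ, 2 ≤ N → ∀ f : Polynomial ℝ, f.natDegree = k →
      f.leadingCoeff ∈ minorArcs (N : ℝ) ((N : ℝ) ^ (1 / 2 : ℝ)) →
        ‖divisorExpSum f N‖ ≤
          C * Real.log (N : ℝ) * (N : ℝ) ^ (1 + ε - weylGamma k / 2) := by
  -- D occurs to the power 2k + 2: 2k + 1 from each dyadic range, and one more for the number of
  -- ranges.
  obtain ⟨C₁, hC₁, hDiv⟩ := exists_divisorBound k (ε := ε / (2 * k + 2)) (by positivity)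
  set c := WeylSetup.dyadicConst k with hc
  have hc0 : 0 ≤ c := by
    rw [hc, WeylSetup.dyadicConst, WeylSetup.doubleSumConst]; positivity
  have hlog2 : 0 < Real.log 2 := Real.log_pos (by norm_num)
  refine ⟨(4 * (c + 1) + 1) * C₁ ^ (2 * k + 2) / Real.log 2, by positivity, fun N hN f hf hα ↦ ?_⟩
  have hN0 : 0 < N := by omega
  have hN1 : (1 : ℝ) ≤ N := by exact_mod_cast hN0
  have hN' : (0 : ℝ) < N := by linarith
  obtain ⟨a, q, hqN, hq, hcop, happ⟩ := exists_approx_of_mem_minorArcs hN0 hα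
  obtain ⟨t, ht0, htN, ht⟩ := exists_pow_le_and_le k N hN0
  have hD := hDiv N hN0
  set D := C₁ * (N : ℝ) ^ (ε / (2 * k + 2)) with hDdef
  have hD1 := hD.one_le hN0
  have hDpow : D ^ (2 * k + 2) = C₁ ^ (2 * k + 2) * (N : ℝ) ^ ε := by
    rw [hDdef, mul_pow, ← Real.rpow_natCast ((N : ℝ) ^ _), ← Real.rpow_mul hN'.le]
    congr 2
    push_cast; field_simp
  set V := (N : ℝ) ^ (1 - weylGamma k / 2) with hV
  set s := N.sqrt with hs
  have hs0 : 0 < s := Nat.sqrt_pos.mpr hN0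
  set T : ℕ → ℝ := fun x ↦
    ‖∑ y ∈ Finset.Ioc x (N / x), expTwoPiI (f.eval ((x * y : ℕ) : ℝ))‖ with hT
  have hTsum : ∑ x ∈ Finset.Icc 1 s, T x ≤ 2 * (c + 1) * D ^ (2 * k + 2) * V := by
    have hlogs : (Nat.log 2 s : ℝ) + 1 ≤ D := by
      refine le_trans ?_ (hD.log_le hN0)
      gcongr
      exact Nat.sqrt_le_self N
    calc ∑ x ∈ Finset.Icc 1 s, T x
        ≤ ∑ i ∈ Finset.range (Nat.log 2 s + 1), ∑ x ∈ Finset.Ico (2 ^ i) (2 * 2 ^ i), T x :=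
          sum_Icc_le_sum_dyadic (fun _ ↦ norm_nonneg _) s
      _ ≤ ∑ i ∈ Finset.range (Nat.log 2 s + 1), 2 * (c + 1) * D ^ (2 * k + 1) * V := by
          refine Finset.sum_le_sum fun i hi ↦ ?_
          rw [Finset.mem_range] at hi
          exact sum_dyadic_le hk ht0 htN ht hqN hq hcop happ hD hf rfl (by positivity)
            ((Nat.pow_le_pow_right (by norm_num) (Nat.le_of_lt_succ hi)).trans
              (Nat.pow_log_le_self 2 hs0.ne'))
      _ = (Nat.log 2 s + 1) * (2 * (c + 1) * D ^ (2 * k + 1) * V) := by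
          rw [Finset.sum_const, Finset.card_range, nsmul_eq_mul]; push_cast; ring
      _ ≤ D * (2 * (c + 1) * D ^ (2 * k + 1) * V) := by gcongr
      _ = _ := by ring
  -- This makes √N ≤ V, so that the diagonal of the hyperbola is negligible.
  have hγ : weylGamma k ≤ 1 := by
    rw [weylGamma]
    refine Real.rpow_le_one_of_one_le_of_nonpos (by norm_num) ?_
    have : (2 : ℝ) ≤ k := by exact_mod_cast hk
    linarith
  have hsV : (s : ℝ) ≤ V := by
    calc (s : ℝ) ≤ Real.sqrt N := Real.nat_sqrt_le_real_sqrt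
      _ = (N : ℝ) ^ (1 / 2 : ℝ) := Real.sqrt_eq_rpow _
      _ ≤ V := Real.rpow_le_rpow_of_exponent_le hN1 (by linarith)
  have hV0 : 0 < V := by positivity
  have hbound : ‖divisorExpSum f N‖ ≤ (4 * (c + 1) + 1) * D ^ (2 * k + 2) * V := by
    have hhyp := sum_card_divisors_mul (fun n ↦ expTwoPiI (f.eval (n : ℝ))) N
    rw [divisorExpSum, hhyp]
    have e1 : ‖(2 : ℂ) * ∑ x ∈ Finset.Icc 1 s, ∑ y ∈ Finset.Ioc x (N / x),
        expTwoPiI (f.eval ((x * y : ℕ) : ℝ))‖ ≤ 2 * ∑ x ∈ Finset.Icc 1 s, T x := by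
      rw [norm_mul, Complex.norm_ofNat]
      gcongr
      exact norm_sum_le _ _
    have e2 : ‖∑ x ∈ Finset.Icc 1 s, expTwoPiI (f.eval ((x * x : ℕ) : ℝ))‖ ≤ s := by
      refine (norm_sum_le _ _).trans (le_of_eq ?_)
      simp [norm_expTwoPiI]
    have e3 : V ≤ D ^ (2 * k + 2) * V := le_mul_of_one_le_left hV0.le (one_le_pow₀ hD1)
    refine (norm_add_le _ _).trans ?_
    linarith
  -- All logarithms are already inside D; the factor log N is merely inserted, using N ≥ 2.
  have hlogN : 1 ≤ Real.log N / Real.log 2 := by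
    rw [one_le_div hlog2]
    exact Real.log_le_log (by norm_num) (by exact_mod_cast hN)
  calc ‖divisorExpSum f N‖ ≤ (4 * (c + 1) + 1) * D ^ (2 * k + 2) * V := hbound
    _ = (4 * (c + 1) + 1) * C₁ ^ (2 * k + 2) * ((N : ℝ) ^ ε * V) * 1 := by rw [hDpow]; ring
    _ ≤ (4 * (c + 1) + 1) * C₁ ^ (2 * k + 2) * ((N : ℝ) ^ ε * V) *
          (Real.log N / Real.log 2) := by gcongr
    _ = (4 * (c + 1) + 1) * C₁ ^ (2 * k + 2) / Real.log 2 * Real.log N *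
          (N : ℝ) ^ (1 + ε - weylGamma k / 2) := by
        rw [hV, ← Real.rpow_add hN', show ε + (1 - weylGamma k / 2) = 1 + ε - weylGamma k / 2 by ring]
        ring
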